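/- Let $q\ge 2$ be an integer and, for $n\in\mathbb N$, let $Q_n=\{0,1,\dots,q-1\}^n$, equipped with the uniform probability measure $\mu$. For $f\in\mathbb R[x_1,\dots,x_n]$ put $f_{\min}=\min_{x\in Q_n}f(x)$ and $\|f\|_\infty=\max_{x\in Q_n}|f(x)|$. For $r\in\mathbb N$ let $\Sigma_r$ be the set of finite sums $\sum_i p_i^2$ with $p_i\in\mathbb R[x_1,\dots,x_n]$ and $\deg p_i\le r$, and define the outer and inner bounds \[ f_{(r)}=\sup\{\lambda\in\mathbb R:\ \exists s\in\Sigma_r\ \ f(x)-\lambda=s(x)\ \ \forall x\in Q_n\},\qquad f^{(r)}=\inf\Big\{\int_{Q_n} f s\,d\mu:\ s\in\Sigma_r,\ \int_{Q_n}s\,d\mu=1\Big\}, \] where $\sup\emptyset=-\infty$. Fix an integer $d\ge 0$ and define the worst-case errors (with values in $[0,+\infty]$) \[ E_{(r)}(n)=\sup\{f_{\min}-f_{(r)}\},\qquad E^{(r)}(n)=\sup\{f^{(r)}-f_{\min}\}, \] both suprema being over all $f\in\mathbb R[x_1,\dots,x_n]$ with $\deg f\le (q-1)d$ and $\|f\|_\infty=1$.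 Let \[ \varphi_q(t)=\frac{q-1}{q}-\Big(\frac{q-2}{q}\,t+\frac2q\sqrt{(q-1)t(1-t)}\Big). \] Then there is a constant $C_d>0$, depending only on $d$ and $q$, such that for every $t\in[0,\frac{q-1}{q}]$ and all sequences $(n_j)_j$, $(r_j)_j$ of natural numbers with $n_j\to\infty$ and $r_j/n_j\to t$, \[ \limsup_{j\to\infty}E^{((q-1)r_j)}(n_j)\le C_d\,\varphi_q(t), \] and, if moreover $d(d+1)\varphi_q(t)\le\frac12$, \[ \limsup_{j\to\infty}E_{((q-1)r_j)}(n_j)\le 2C_d\,\varphi_q(t). \] -/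

import Mathlib

noncomputable section

namespace QaryCube

/-- The value of the polynomial `f` at the point `x` of the `q`-ary cube `{0, …, q-1}^n`. -/
def value {q n : ℕ} (f : MvPolynomial (Fin n) ℝ) (x : Fin n → Fin q) : ℝ :=
  MvPolynomial.eval (fun i => ((x i : ℕ) : ℝ)) f

/-- The minimum of `f` over the `q`-ary cube. -/
def minValue (q : ℕ) {n : ℕ} (f : MvPolynomial (Fin n) ℝ) : ℝ :=
  ⨅ x : Fin n → Fin q, value f x

/-- The maximum of `|f|` over the `q`-ary cube. -/
def supNorm (q : ℕ) {n : ℕ} (f : MvPolynomial (Fin n) ℝ) : ℝ :=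
  ⨆ x : Fin n → Fin q, |value f x|

/-- The integral of `f` against the uniform probability measure on the `q`-ary cube. -/
def integral (q : ℕ) {n : ℕ} (f : MvPolynomial (Fin n) ℝ) : ℝ :=
  (1 / (q : ℝ) ^ n) * ∑ x : Fin n → Fin q, value f x

/-- `s` is a finite sum of squares of polynomials of degree at most `r`. -/
def IsSOS {n : ℕ} (r : ℕ) (s : MvPolynomial (Fin n) ℝ) : Prop :=
  ∃ (m : ℕ) (p : Fin m → MvPolynomial (Fin n) ℝ),
    (∀ i, (p i).totalDegree ≤ r) ∧ s = ∑ i, p i ^ 2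

/-- The outer bound of level `r`: the supremum of all real `lam` such that `f - lam` agrees on
the `q`-ary cube with a sum of squares of degree at most `2 r`. It is `⊥` if there is none. -/
def lowerBound (q : ℕ) {n : ℕ} (r : ℕ) (f : MvPolynomial (Fin n) ℝ) : EReal :=
  ⨆ (lam : ℝ) (_ : ∃ s : MvPolynomial (Fin n) ℝ, IsSOS r s ∧
    ∀ x : Fin n → Fin q, value f x - lam = value s x), (lam : EReal)

/-- The inner bound of level `r`: the infimum of `∫ f s dμ` over the sums of squares `s` of degree
at most `2 r` with `∫ s dμ = 1`, where `μ` is the uniform probability measure on the cube. -/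
def upperBound (q : ℕ) {n : ℕ} (r : ℕ) (f : MvPolynomial (Fin n) ℝ) : EReal :=
  ⨅ (s : MvPolynomial (Fin n) ℝ) (_ : IsSOS r s ∧ integral q s = 1),
    ((integral q (f * s) : ℝ) : EReal)

/-- The worst-case error of the outer bound of level `r` over the polynomials in `n` variables
of degree at most `D` with supremum norm `1` on the `q`-ary cube. -/
def outerError (q D r n : ℕ) : EReal :=
  ⨆ (f : MvPolynomial (Fin n) ℝ) (_ : f.totalDegree ≤ D ∧ supNorm q f = 1),
    (minValue q f : EReal) - lowerBound q r f

/-- The worst-case error of the inner bound of level `r` over the polynomials in `n` variables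
of degree at most `D` with supremum norm `1` on the `q`-ary cube. -/
def innerError (q D r n : ℕ) : EReal :=
  ⨆ (f : MvPolynomial (Fin n) ℝ) (_ : f.totalDegree ≤ D ∧ supNorm q f = 1),
    upperBound q r f - (minValue q f : EReal)

/-- The function `φ_q`. -/
def phi (q : ℕ) (t : ℝ) : ℝ :=
  ((q : ℝ) - 1) / q - (((q : ℝ) - 2) / q * t + 2 / q * √(((q : ℝ) - 1) * t * (1 - t)))

end QaryCube

end

/-! Regard the cube as the group (ℤ/q)^n and split f into its components `comp f S`, which vanish
for |S| > D = (q-1)d. Convolution with a weight w that depends only on the zero pattern and is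
invariant under permutations of the coordinates multiplies `comp f S` by an eigenvalue c_k, k = |S|.
Take w = u², where u = `rad ν` involves only sets of size at most r; interpolating in each
coordinate makes x ↦ u(x - y) a polynomial of degree at most (q-1)r.

For the inner bound, the density u(x - x₀)² at a minimizer x₀ has error Σ (c_k - 1) `level f k x₀`
(`upperBound_le`). For the outer bound the convolution is undone: g = Σ c_k⁻¹ `level f k` stays
above f_min - ε, and convolving the nonnegative function g - (f_min - ε) with u² exhibits f - (f_min
- ε) as a sum of squares (`le_lowerBound`).

Both errors are then controlled by three facts. The levels are bounded independently of n: the noise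
operators contract the supremum norm, so the polynomial Σ ρ^k `level f k x` is bounded on [0, 1],
hence so are its coefficients (`exists_level_bound`). Next, 1 - c_k ≤ k (1 - c_1)
(`IsWeight.one_sub_eig_le`). Finally, c_1 is a quadratic form in ν given by a tridiagonal matrix,
and a flat vector on a window of l + 1 levels ending at r makes 1 - c_1 at most q/(q-1) φ_q(t) up to
an error that vanishes as n, then l, grow (`exists_rad`, `eventually_exists_rad`).

The outer bound also needs c_k bounded away from 0 for k ≤ D (`IsWeight.le_eig`). If q = 2, the
second fact suffices. If q ≥ 3, k runs up to (q-1)d, too far for that estimate; instead c_k is at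
least the k-th moment of `meanSgn` under w minus O(1/n), and since `meanSgn` ≥ -1/2, Bernoulli's
inequality bounds this moment from below. -/

noncomputable section

namespace QaryCube

/-! ### Averages on the cube and the decomposition into components -/

section

variable {q n : ℕ}

/-- The average of a function over the `q`-ary cube. -/
def avg (F : (Fin n → Fin q) → ℝ) : ℝ :=
  (1 / (q : ℝ) ^ n) * ∑ z : Fin n → Fin q, F z

lemma avg_add (F H : (Fin n → Fin q) → ℝ) : avg (fun z => F z + H z) = avg F + avg H := by
  simp [avg, Finset.sum_add_distrib, mul_add]

lemma avg_const_mul (c : ℝ) (F : (Fin n → Fin q) → ℝ) :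
    avg (fun z => c * F z) = c * avg F := by
  simp only [avg, ← Finset.mul_sum]; ring

lemma avg_mul_const (c : ℝ) (F : (Fin n → Fin q) → ℝ) :
    avg (fun z => F z * c) = avg F * c := by
  simp only [avg, ← Finset.sum_mul]; ring

lemma avg_sub (F H : (Fin n → Fin q) → ℝ) : avg (fun z => F z - H z) = avg F - avg H := by
  simp [avg, Finset.sum_sub_distrib, mul_sub]

lemma avg_sum {ι : Type*} (s : Finset ι) (F : ι → (Fin n → Fin q) → ℝ) :
    avg (fun z => ∑ i ∈ s, F i z) = ∑ i ∈ s, avg (F i) := by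
  simp only [avg]
  rw [Finset.sum_comm, Finset.mul_sum]

lemma avg_mono {F H : (Fin n → Fin q) → ℝ} (h : ∀ z, F z ≤ H z) : avg F ≤ avg H := by
  unfold avg
  gcongr with z
  exact h z

lemma avg_comm (F : (Fin n → Fin q) → (Fin n → Fin q) → ℝ) :
    avg (fun z => avg (fun y => F z y)) = avg (fun y => avg (fun z => F z y)) := by
  simp only [avg, Finset.mul_sum]
  rw [Finset.sum_comm]

lemma abs_avg_le (F : (Fin n → Fin q) → ℝ) : |avg F| ≤ avg (fun z => |F z|) := by
  unfold avg
  rw [abs_mul, abs_of_nonneg (by positivity : (0 : ℝ) ≤ 1 / (q : ℝ) ^ n)]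
  gcongr
  exact Finset.abs_sum_le_sum_abs _ _

/-- Averages of product functions factor. -/
lemma avg_prod (h : Fin n → Fin q → ℝ) :
    avg (fun z => ∏ i, h i (z i)) = ∏ i, ((1 / (q : ℝ)) * ∑ b, h i b) := by
  rw [Finset.prod_mul_distrib, Finset.prod_univ_sum]
  simp [avg]

lemma avg_perm (σ : Equiv.Perm (Fin n)) (F : (Fin n → Fin q) → ℝ) :
    avg (fun z => F (z ∘ σ)) = avg F := by
  unfold avg
  congr 1
  exact Fintype.sum_equiv (Equiv.arrowCongr σ.symm (Equiv.refl _)) _ _ (fun _ => rfl)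

lemma sum_sum_update (i : Fin n) (F : (Fin n → Fin q) → ℝ) :
    ∑ z, ∑ b, F (Function.update z i b) = q * ∑ z, F z := by
  have h : ∑ p : (Fin n → Fin q) × Fin q, F (Function.update p.1 i p.2)
      = ∑ p : (Fin n → Fin q) × Fin q, F p.1 := by
    -- Exchanging the i-th coordinate of z with b is an involution.
    refine Finset.sum_bij' (fun p _ => (Function.update p.1 i p.2, p.1 i))
      (fun p _ => (Function.update p.1 i p.2, p.1 i)) ?_ ?_ ?_ ?_ ?_ <;> simp
  rw [Fintype.sum_prod_type, Fintype.sum_prod_type] at h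
  rw [h]
  simp [Finset.mul_sum]

section

variable [NeZero q]

lemma avg_const (c : ℝ) : avg (fun _ : Fin n → Fin q => c) = c := by
  have : (q : ℝ) ≠ 0 := Nat.cast_ne_zero.2 (NeZero.ne q)
  simp [avg, this]

lemma avg_shift (v : Fin n → Fin q) (F : (Fin n → Fin q) → ℝ) :
    avg (fun z => F (v + z)) = avg F := by
  unfold avg
  congr 1
  exact Fintype.sum_equiv (Equiv.addLeft v) _ _ (fun _ => rfl)

/-- Two functions have the same average if their sums over one coordinate agree. -/
lemma avg_congr_update (i : Fin n) {F H : (Fin n → Fin q) → ℝ}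
    (h : ∀ z, ∑ b, F (Function.update z i b) = ∑ b, H (Function.update z i b)) :
    avg F = avg H := by
  have hq : (q : ℝ) ≠ 0 := Nat.cast_ne_zero.2 (NeZero.ne q)
  unfold avg
  congr 1
  apply mul_left_cancel₀ hq
  rw [← sum_sum_update i F, ← sum_sum_update i H]
  exact Finset.sum_congr rfl (fun z _ => h z)

/-- The function on `Fin q` which is `q` times the indicator of `0`, minus `1`. -/
def gen (b : Fin q) : ℝ := if b = 0 then (q : ℝ) - 1 else -1

lemma gen_eq (b : Fin q) : gen b = (if b = 0 then (q : ℝ) else 0) - 1 := by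
  unfold gen; split_ifs <;> simp

lemma sum_gen_sub (v : Fin q) : ∑ b, gen (v - b) = 0 := by
  simp [gen_eq, sub_eq_zero]

lemma sum_gen : ∑ b : Fin q, gen b = 0 := by
  simp [gen_eq]

/-- The two values q - 1 and -1 are the roots of this quadratic; its linear term is the source of q
- 2 in `phi`. -/
lemma gen_sq (b : Fin q) : gen b * gen b = ((q : ℝ) - 2) * gen b + (q - 1) := by
  unfold gen; split_ifs <;> ring

lemma neg_one_le_gen (b : Fin q) : -1 ≤ gen b := by
  have : (0 : ℝ) ≤ q := Nat.cast_nonneg q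
  unfold gen; split_ifs <;> linarith

lemma gen_le (b : Fin q) : gen b ≤ q - 1 := by
  have : (0 : ℝ) ≤ q := Nat.cast_nonneg q
  unfold gen; split_ifs <;> linarith

/-- The product of `gen` over the coordinates in `S`: the kernel of the projection onto the
functions that depend exactly on the coordinates in `S`. -/
def ker (S : Finset (Fin n)) (z : Fin n → Fin q) : ℝ := ∏ i ∈ S, gen (z i)

lemma ker_eq_prod_univ (S : Finset (Fin n)) (z : Fin n → Fin q) :
    ker S z = ∏ i, if i ∈ S then gen (z i) else 1 := by
  simp [ker, Finset.prod_ite_mem]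

/-- The orthogonality relations of the kernels. -/
lemma avg_ker_mul_ker (S T : Finset (Fin n)) :
    avg (fun z : Fin n → Fin q => ker S z * ker T z) =
      if S = T then ((q : ℝ) - 1) ^ T.card else 0 := by
  have hq : (q : ℝ) ≠ 0 := Nat.cast_ne_zero.2 (NeZero.ne q)
  have h1 : avg (fun z : Fin n → Fin q => ker S z * ker T z) =
      ∏ i, ((1 / (q : ℝ)) * ∑ b : Fin q, (if i ∈ S then gen b else 1) *
        (if i ∈ T then gen b else 1)) := by
    rw [← avg_prod]
    simp only [ker_eq_prod_univ, ← Finset.prod_mul_distrib]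
  rw [h1]
  split_ifs with h
  · subst h
    have : ∀ i, ((1 / (q : ℝ)) * ∑ b : Fin q, (if i ∈ S then gen b else 1) *
        (if i ∈ S then gen b else 1)) = if i ∈ S then (q : ℝ) - 1 else 1 := by
      intro i
      split_ifs
      · simp only [gen_sq, Finset.sum_add_distrib, ← Finset.mul_sum, sum_gen]
        simp
        field_simp
      · simp [hq]
    rw [Finset.prod_congr rfl fun i _ => this i]
    simp [Finset.prod_ite_mem]
  · have : ∃ i, ¬ (i ∈ S ↔ i ∈ T) := by
      by_contra hc
      push Not at hc
      exact h (Finset.ext hc)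
    obtain ⟨i, hi⟩ := this
    apply Finset.prod_eq_zero (Finset.mem_univ i)
    by_cases hS : i ∈ S
    · have hT : i ∉ T := by tauto
      simp [hS, hT, sum_gen]
    · have hT : i ∈ T := by tauto
      simp [hS, hT, sum_gen]

lemma avg_ker (S : Finset (Fin n)) :
    avg (fun z : Fin n → Fin q => ker S z) = if S = ∅ then 1 else 0 := by
  have := avg_ker_mul_ker (q := q) S ∅
  simpa [ker] using this

lemma sum_pow_card_mul_ker (ρ : ℝ) (z : Fin n → Fin q) :
    ∑ S : Finset (Fin n), ρ ^ S.card * ker S z = ∏ i, (1 + ρ * gen (z i)) := by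
  rw [Finset.prod_one_add]
  simp [ker, Finset.prod_mul_distrib]

/-- The component of `f` that depends exactly on the coordinates in `S`. -/
def comp (f : (Fin n → Fin q) → ℝ) (S : Finset (Fin n)) (x : Fin n → Fin q) : ℝ :=
  avg (fun z => ker S z * f (x + z))

lemma sum_pow_card_mul_comp (f : (Fin n → Fin q) → ℝ) (ρ : ℝ) (x : Fin n → Fin q) :
    ∑ S : Finset (Fin n), ρ ^ S.card * comp f S x =
      avg (fun z => (∏ i, (1 + ρ * gen (z i))) * f (x + z)) := by
  simp only [comp, ← sum_pow_card_mul_ker, Finset.sum_mul, avg_sum, ← avg_const_mul, mul_assoc]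

/-- At ρ = 1 the noise kernel ∏ (1 + `gen`) is q^n times the indicator of 0. -/
lemma sum_comp (f : (Fin n → Fin q) → ℝ) (x : Fin n → Fin q) :
    ∑ S : Finset (Fin n), comp f S x = f x := by
  have hq : (q : ℝ) ≠ 0 := Nat.cast_ne_zero.2 (NeZero.ne q)
  have h := sum_pow_card_mul_comp f 1 x
  simp only [one_pow, one_mul] at h
  rw [h]
  have h2 : ∀ z : Fin n → Fin q, (∏ i, (1 + gen (z i))) * f (x + z) =
      if z = 0 then (q : ℝ) ^ n * f x else 0 := by
    intro z
    split_ifs with hz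
    · subst hz; simp [gen]
    · obtain ⟨i, hi⟩ := Function.ne_iff.1 hz
      rw [Finset.prod_eq_zero (Finset.mem_univ i), zero_mul]
      simp only [Pi.zero_apply] at hi
      simp [gen, hi]
  simp only [h2, avg]
  simp [hq]

/-- The noise operator is a contraction for the supremum norm. -/
lemma abs_sum_pow_card_mul_comp_le {f : (Fin n → Fin q) → ℝ} {M : ℝ} (hf : ∀ x, |f x| ≤ M)
    {ρ : ℝ} (h0 : 0 ≤ ρ) (h1 : ρ ≤ 1) (x : Fin n → Fin q) :
    |∑ S : Finset (Fin n), ρ ^ S.card * comp f S x| ≤ M := by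
  rw [sum_pow_card_mul_comp]
  have hpos : ∀ z : Fin n → Fin q, 0 ≤ ∏ i, (1 + ρ * gen (z i)) := fun z =>
    Finset.prod_nonneg fun i _ => by nlinarith [neg_one_le_gen (z i)]
  have hone : avg (fun z : Fin n → Fin q => ∏ i, (1 + ρ * gen (z i))) = 1 := by
    simp only [← sum_pow_card_mul_ker, avg_sum, avg_const_mul, avg_ker]
    simp
  calc _ ≤ avg (fun z => |(∏ i, (1 + ρ * gen (z i))) * f (x + z)|) := abs_avg_le _
    _ ≤ avg (fun z => (∏ i, (1 + ρ * gen (z i))) * M) := by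
        apply avg_mono
        intro z
        rw [abs_mul, abs_of_nonneg (hpos z)]
        exact mul_le_mul_of_nonneg_left (hf _) (hpos z)
    _ = M := by rw [avg_mul_const, hone, one_mul]

lemma comp_sum {ι : Type*} (s : Finset ι) (f : ι → (Fin n → Fin q) → ℝ) (S : Finset (Fin n))
    (x : Fin n → Fin q) :
    comp (fun y => ∑ i ∈ s, f i y) S x = ∑ i ∈ s, comp (f i) S x := by
  simp only [comp, Finset.mul_sum, avg_sum]

/-- Averaging first over coordinate i leaves the sum of `gen`, which is 0. -/
lemma comp_eq_zero_of_update {f : (Fin n → Fin q) → ℝ} {S : Finset (Fin n)} {i : Fin n}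
    (hi : i ∈ S) (hf : ∀ x b, f (Function.update x i b) = f x) (x : Fin n → Fin q) :
    comp f S x = 0 := by
  have : avg (fun _ : Fin n → Fin q => (0 : ℝ)) = 0 := avg_const 0
  rw [comp, ← this]
  apply avg_congr_update i
  intro z
  have h1 : ∀ b, f (x + Function.update z i b) = f (x + z) := by
    intro b
    rw [← hf (x + z) (x i + b)]
    congr 1
    ext j
    by_cases hj : j = i
    · subst hj; simp
    · simp [hj]
  have h2 : ∀ b, ker S (Function.update z i b) = gen b * ∏ j ∈ S.erase i, gen (z j) := by
    intro b
    rw [ker, ← Finset.mul_prod_erase S _ hi]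
    congr 1
    · simp
    · refine Finset.prod_congr rfl fun j hj => ?_
      rw [Function.update_of_ne (Finset.ne_of_mem_erase hj)]
  simp only [h1, h2, ← Finset.sum_mul, sum_gen]
  simp

/-- A monomial involves at most as many variables as its degree, so it misses some coordinate of S.
-/
lemma comp_value_eq_zero {f : MvPolynomial (Fin n) ℝ} {S : Finset (Fin n)}
    (h : f.totalDegree < S.card) (x : Fin n → Fin q) : comp (fun y => value f y) S x = 0 := by
  have hv : (fun y : Fin n → Fin q => value f y) = fun y => ∑ m ∈ f.support,
      f.coeff m * ∏ i, ((y i : ℕ) : ℝ) ^ m i := by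
    ext y
    rw [value, MvPolynomial.eval_eq']
  rw [hv, comp_sum]
  refine Finset.sum_eq_zero fun m hm => ?_
  have hex : ∃ i ∈ S, i ∉ m.support := by
    by_contra hc
    push Not at hc
    have h1 : S.card ≤ m.support.card := Finset.card_le_card hc
    have h2 : m.support.card ≤ m.sum fun _ e => e := by
      rw [Finsupp.sum, Finset.card_eq_sum_ones]
      refine Finset.sum_le_sum fun i hi => ?_
      exact Nat.one_le_iff_ne_zero.2 (Finsupp.mem_support_iff.1 hi)
    have h3 := MvPolynomial.le_totalDegree hm
    omega
  obtain ⟨i, hiS, him⟩ := hex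
  refine comp_eq_zero_of_update hiS (fun y b => ?_) x
  congr 1
  refine Finset.prod_congr rfl fun j _ => ?_
  by_cases hj : j = i
  · subst hj
    simp [Finsupp.notMem_support_iff.1 him]
  · rw [Function.update_of_ne hj]

/-- The sum of the components of `f` over the sets of size `k`. -/
def level (f : (Fin n → Fin q) → ℝ) (k : ℕ) (x : Fin n → Fin q) : ℝ :=
  ∑ S with S.card = k, comp f S x

lemma sum_mul_comp_eq_sum_level {f : (Fin n → Fin q) → ℝ} {D : ℕ}
    (hf : ∀ S : Finset (Fin n), D < S.card → ∀ x, comp f S x = 0) (c : ℕ → ℝ)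
    (x : Fin n → Fin q) :
    ∑ S : Finset (Fin n), c S.card * comp f S x =
      ∑ k ∈ Finset.range (D + 1), c k * level f k x := by
  have h1 : ∑ S : Finset (Fin n), c S.card * comp f S x =
      ∑ S with S.card ∈ Finset.range (D + 1), c S.card * comp f S x := by
    symm
    apply Finset.sum_filter_of_ne
    intro S _ hS
    by_contra hc
    apply hS
    rw [hf S (by simpa using hc) x, mul_zero]
  rw [h1, ← Finset.sum_fiberwise_of_maps_to (t := Finset.range (D + 1)) (g := Finset.card)
    (by intro S hS; simpa using hS)]
  refine Finset.sum_congr rfl fun k hk => ?_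
  rw [level, Finset.mul_sum, Finset.filter_filter]
  refine Finset.sum_congr ?_ ?_
  · ext S
    simp only [Finset.mem_filter, Finset.mem_univ, true_and]
    constructor
    · exact fun h => h.2
    · exact fun h => ⟨h ▸ hk, h⟩
  · intro S hS
    rw [(Finset.mem_filter.1 hS).2]

end

/-! ### Dimension-free bounds for the levels -/

/-- The coefficients of a polynomial of degree at most `D` are bounded by its maximum on
`[0, 1]`, up to a factor that depends only on `D`. -/
lemma exists_coeff_bound (D : ℕ) : ∃ γ : ℝ, 0 ≤ γ ∧ ∀ (a : ℕ → ℝ) (M : ℝ),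
    (∀ ρ : ℝ, 0 ≤ ρ → ρ ≤ 1 → |∑ k ∈ Finset.range (D + 1), ρ ^ k * a k| ≤ M) →
      ∀ k ∈ Finset.range (D + 1), |a k| ≤ γ * M := by
  -- Any D + 1 distinct nodes in [0, 1] would do; the entries of the inverse Vandermonde matrix then
  -- give γ.
  let v : Fin (D + 1) → ℝ := fun i => 1 / ((i : ℕ) + 1 : ℝ)
  let V := Matrix.vandermonde v
  have hdet : IsUnit V.det := by
    rw [isUnit_iff_ne_zero, Matrix.det_vandermonde_ne_zero_iff]
    intro i j hij
    simp only [v, one_div, inv_inj, add_left_inj, Nat.cast_inj] at hij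
    exact Fin.ext hij
  refine ⟨∑ i, ∑ j, |V⁻¹ i j|, by positivity, fun a M h k hk => ?_⟩
  let A : Fin (D + 1) → ℝ := fun i => a i
  have hM : ∀ j, |V.mulVec A j| ≤ M := by
    intro j
    have := h (v j) (by positivity) (by
      simp only [v]
      rw [div_le_one (by positivity)]
      linarith [Nat.cast_nonneg (α := ℝ) (j : ℕ)])
    rw [← Fin.sum_univ_eq_sum_range (fun k => v j ^ k * a k)] at this
    simpa [Matrix.mulVec, dotProduct, V, A, Matrix.vandermonde] using this
  have hM0 : 0 ≤ M := (abs_nonneg _).trans (hM 0)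
  have hA : A = V⁻¹.mulVec (V.mulVec A) := by
    rw [Matrix.mulVec_mulVec, Matrix.nonsing_inv_mul _ hdet, Matrix.one_mulVec]
  have hk' : k < D + 1 := Finset.mem_range.1 hk
  have : a k = ∑ j, V⁻¹ ⟨k, hk'⟩ j * V.mulVec A j := congrFun hA ⟨k, hk'⟩
  rw [this]
  calc _ ≤ ∑ j, |V⁻¹ ⟨k, hk'⟩ j * V.mulVec A j| := Finset.abs_sum_le_sum_abs _ _
    _ ≤ ∑ j, |V⁻¹ ⟨k, hk'⟩ j| * M := by
        refine Finset.sum_le_sum fun j _ => ?_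
        rw [abs_mul]
        exact mul_le_mul_of_nonneg_left (hM j) (abs_nonneg _)
    _ = (∑ j, |V⁻¹ ⟨k, hk'⟩ j|) * M := by rw [Finset.sum_mul]
    _ ≤ _ := by
        refine mul_le_mul_of_nonneg_right ?_ hM0
        exact Finset.single_le_sum (f := fun i => ∑ j, |V⁻¹ i j|)
          (fun i _ => Finset.sum_nonneg fun j _ => abs_nonneg _) (Finset.mem_univ _)

/-- The levels of a function of degree at most `D` are bounded by its supremum norm, up to a
factor that does not depend on the dimension. -/
lemma exists_level_bound (D : ℕ) : ∃ γ : ℝ, 0 ≤ γ ∧ ∀ (q n : ℕ) [NeZero q]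
    (f : (Fin n → Fin q) → ℝ) (M : ℝ), (∀ x, |f x| ≤ M) →
    (∀ S : Finset (Fin n), D < S.card → ∀ x, comp f S x = 0) →
    ∀ k ∈ Finset.range (D + 1), ∀ x, |level f k x| ≤ γ * M := by
  obtain ⟨γ, hγ, h⟩ := exists_coeff_bound D
  refine ⟨γ, hγ, fun q n _ f M hM hf k hk x => ?_⟩
  refine h (fun k => level f k x) M (fun ρ h0 h1 => ?_) k hk
  rw [← sum_mul_comp_eq_sum_level hf (fun k => ρ ^ k)]
  exact abs_sum_pow_card_mul_comp_le hM h0 h1 x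

end

/-! ### Symmetric weights, their convolution operators and eigenvalues -/

section

variable {q n : ℕ}

/-- `w` is invariant under permutations of the coordinates. -/
def Symm (w : (Fin n → Fin q) → ℝ) : Prop :=
  ∀ (σ : Equiv.Perm (Fin n)) z, w (z ∘ σ) = w z

lemma Symm.mul {w v : (Fin n → Fin q) → ℝ} (hw : Symm w) (hv : Symm v) :
    Symm (fun z => w z * v z) := fun σ z => by
  simp only [hw σ z, hv σ z]

lemma abs_avg_mul_le {w v : (Fin n → Fin q) → ℝ} (hb : avg (fun z => |w z|) ≤ 1)
    (hv : ∀ z, |v z| ≤ 1) : |avg (fun z => w z * v z)| ≤ 1 := by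
  refine (abs_avg_le _).trans (le_trans (avg_mono fun z => ?_) hb)
  rw [abs_mul]
  exact mul_le_of_le_one_right (abs_nonneg _) (hv z)

variable [NeZero q]

/-- `w z` depends only on the set of coordinates where `z` vanishes. -/
def PatternDep (w : (Fin n → Fin q) → ℝ) : Prop :=
  ∀ z z', (∀ i, z i = 0 ↔ z' i = 0) → w z = w z'

/-- `gen`, normalized to have value `1` at `0`. -/
def sgn (b : Fin q) : ℝ := gen b / (q - 1)

/-- The eigenvalue on the `S`-components of the convolution operator with kernel `w`. -/
def eig (w : (Fin n → Fin q) → ℝ) (S : Finset (Fin n)) : ℝ :=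
  avg (fun z => w z * ∏ i ∈ S, sgn (z i))

lemma gen_eq_of_iff {b c : Fin q} (h : b = 0 ↔ c = 0) : gen b = gen c := by
  simp [gen, h]

lemma PatternDep.mul_sgn {w : (Fin n → Fin q) → ℝ} (hw : PatternDep w) (i : Fin n) :
    PatternDep (fun z => w z * sgn (z i)) := by
  intro z z' h
  simp only [sgn, hw z z' h, gen_eq_of_iff (h i)]

/-- W is a constant plus a multiple of the indicator of 0. The constant is annihilated by `gen`,
which sums to 0, and the indicator merely evaluates at b = 0. -/
lemma sum_pattern_mul_gen_sub (hq : 2 ≤ q) (v : Fin q) (W : Fin q → ℝ)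
    (hW : ∀ b c, b ≠ 0 → c ≠ 0 → W b = W c) :
    ∑ b, W b * gen (v - b) = ∑ b, W b * sgn b * gen v := by
  have hq1 : (q : ℝ) - 1 ≠ 0 := by
    have : (2 : ℝ) ≤ q := by exact_mod_cast hq
    linarith
  have hone : (⟨1, by omega⟩ : Fin q) ≠ 0 := by
    intro h
    have := congrArg Fin.val h
    simp at this
  obtain ⟨W₁, hW₁⟩ : ∃ W₁, ∀ b, W b = W₁ + if b = 0 then W 0 - W₁ else 0 := by
    refine ⟨W ⟨1, by omega⟩, fun b => ?_⟩
    split_ifs with h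
    · rw [h]; ring
    · rw [hW b _ h hone]; ring
  have h1 : ∑ b, W b * gen (v - b) = (W 0 - W₁) * gen v := by
    have : ∀ b, W b * gen (v - b) =
        W₁ * gen (v - b) + if b = 0 then (W 0 - W₁) * gen v else 0 := by
      intro b
      rw [hW₁ b]
      split_ifs with h
      · rw [h, sub_zero]; ring
      · ring
    simp [this, Finset.sum_add_distrib, ← Finset.mul_sum, sum_gen_sub]
  have h2 : ∑ b, W b * sgn b = W 0 - W₁ := by
    have : ∀ b, W b * sgn b = W₁ / (q - 1) * gen b + if b = 0 then W 0 - W₁ else 0 := by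
      intro b
      rw [hW₁ b, sgn]
      split_ifs with h
      · subst h
        simp only [gen, if_true]
        field_simp
      · ring
    simp [this, Finset.sum_add_distrib, ← Finset.mul_sum, sum_gen]
  rw [← Finset.sum_mul, h1, h2]

/-- The kernels `ker S` are eigenfunctions of the convolution with `w`. -/
lemma avg_mul_ker_sub (hq : 2 ≤ q) {w : (Fin n → Fin q) → ℝ} (hw : PatternDep w)
    (S : Finset (Fin n)) (v : Fin n → Fin q) :
    avg (fun z => w z * ker S (v - z)) = eig w S * ker S v := by
  induction S using Finset.induction_on generalizing w with
  | empty => simp [ker, eig]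
  | insert i S hi ih =>
    -- Summing over coordinate i moves a factor `sgn (z i)` into the weight, which is why the
    -- induction generalizes w.
    have h1 : avg (fun z => w z * ker (insert i S) (v - z)) =
        avg (fun z => w z * sgn (z i) * ker S (v - z) * gen (v i)) := by
      apply avg_congr_update i
      intro z
      have h2 : ∀ b, ker S (v - Function.update z i b) = ker S (v - z) := by
        intro b
        refine Finset.prod_congr rfl fun j hj => ?_
        have : j ≠ i := fun h => hi (h ▸ hj)
        simp [this]
      have h3 := sum_pattern_mul_gen_sub hq (v i) (fun b => w (Function.update z i b)) (by
        intro b c hb hc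
        apply hw
        intro j
        by_cases hj : j = i
        · subst hj; simp [hb, hc]
        · simp [hj])
      have h4 : ∀ b, ker (insert i S) (v - Function.update z i b) =
          gen (v i - b) * ker S (v - z) := by
        intro b
        rw [ker, Finset.prod_insert hi, ← h2 b]
        simp [ker]
      simp only [h4, h2, Function.update_self]
      calc _ = (∑ b, w (Function.update z i b) * gen (v i - b)) * ker S (v - z) := by
            rw [Finset.sum_mul]
            exact Finset.sum_congr rfl fun b _ => by ring
        _ = _ := by
            rw [h3, Finset.sum_mul]
            exact Finset.sum_congr rfl fun b _ => by ring
    rw [h1, avg_mul_const, ih (hw.mul_sgn i)]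
    simp only [eig, ker, Finset.prod_insert hi, mul_assoc]
    ring

/-- The convolution operator with kernel `w`. -/
def conv (w f : (Fin n → Fin q) → ℝ) (x : Fin n → Fin q) : ℝ :=
  avg (fun z => w z * f (x + z))

lemma conv_comp (hq : 2 ≤ q) {w : (Fin n → Fin q) → ℝ} (hw : PatternDep w)
    (f : (Fin n → Fin q) → ℝ) (S : Finset (Fin n)) (x : Fin n → Fin q) :
    conv w (comp f S) x = eig w S * comp f S x := by
  have h1 : ∀ z, comp f S (x + z) = avg (fun v => ker S (v - z) * f (x + v)) := by
    intro z
    rw [← avg_shift z, comp]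
    simp [add_assoc]
  simp only [conv, h1, ← avg_const_mul]
  rw [avg_comm]
  simp only [← mul_assoc, avg_mul_const, avg_mul_ker_sub hq hw]
  simp only [mul_assoc, avg_const_mul, comp]

lemma conv_sum_mul_comp (hq : 2 ≤ q) {w : (Fin n → Fin q) → ℝ} (hw : PatternDep w)
    (f : (Fin n → Fin q) → ℝ) (c : Finset (Fin n) → ℝ) (x : Fin n → Fin q) :
    conv w (fun y => ∑ S, c S * comp f S y) x = ∑ S, c S * eig w S * comp f S x := by
  calc _ = ∑ S, c S * conv w (comp f S) x := by
        simp only [conv, ← avg_const_mul, ← avg_sum, Finset.mul_sum]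
        congr 1
        ext z
        exact Finset.sum_congr rfl fun S _ => by ring
    _ = _ := by simp only [conv_comp hq hw, mul_assoc]

lemma conv_eq_sum (hq : 2 ≤ q) {w : (Fin n → Fin q) → ℝ} (hw : PatternDep w)
    (f : (Fin n → Fin q) → ℝ) (x : Fin n → Fin q) :
    conv w f x = ∑ S, eig w S * comp f S x := by
  have := conv_sum_mul_comp hq hw f (fun _ => 1) x
  simpa [sum_comp] using this

/-- Some permutation of the coordinates carries S to T. -/
lemma eig_eq_of_card {w : (Fin n → Fin q) → ℝ} (hw : Symm w) {S T : Finset (Fin n)}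
    (h : S.card = T.card) : eig w S = eig w T := by
  obtain ⟨σ, hσ⟩ : ∃ σ : Equiv.Perm (Fin n), T = S.map σ.toEmbedding := by
    let e : {x // x ∈ S} ≃ {x // x ∈ T} := Finset.equivOfCardEq h
    refine ⟨e.extendSubtype, (Finset.eq_of_subset_of_card_le ?_ (by simp [h])).symm⟩
    intro x hx
    obtain ⟨y, hy, rfl⟩ := Finset.mem_map.1 hx
    exact e.extendSubtype_mem y hy
  subst hσ
  rw [eig, ← avg_perm σ, eig]
  congr 1
  ext z
  rw [hw σ z, Finset.prod_map]
  rfl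

lemma sgn_le_one (hq : 2 ≤ q) (b : Fin q) : sgn b ≤ 1 := by
  have : (2 : ℝ) ≤ q := by exact_mod_cast hq
  rw [sgn, div_le_one (by linarith)]
  exact gen_le b

lemma neg_inv_le_sgn (hq : 2 ≤ q) (b : Fin q) : -(1 / ((q : ℝ) - 1)) ≤ sgn b := by
  have : (2 : ℝ) ≤ q := by exact_mod_cast hq
  rw [sgn, ← neg_div]
  gcongr
  · linarith
  · exact neg_one_le_gen b

lemma abs_sgn_le_one (hq : 2 ≤ q) (b : Fin q) : |sgn b| ≤ 1 := by
  have : (2 : ℝ) ≤ q := by exact_mod_cast hq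
  refine abs_le.2 ⟨le_trans ?_ (neg_inv_le_sgn hq b), sgn_le_one hq b⟩
  rw [neg_le_neg_iff, div_le_one (by linarith)]
  linarith

lemma abs_prod_sgn_le_one (hq : 2 ≤ q) (S : Finset (Fin n)) (z : Fin n → Fin q) :
    |∏ i ∈ S, sgn (z i)| ≤ 1 := by
  rw [Finset.abs_prod]
  exact Finset.prod_le_one (fun i _ => abs_nonneg _) fun i _ => abs_sgn_le_one hq _

/-- Induction via 1 - sp = (1 - p) + p (1 - s), with p ≤ 1 and s ≤ 1. -/
lemma one_sub_prod_sgn_le (hq : 2 ≤ q) (S : Finset (Fin n)) (z : Fin n → Fin q) :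
    1 - ∏ i ∈ S, sgn (z i) ≤ ∑ i ∈ S, (1 - sgn (z i)) := by
  induction S using Finset.induction_on with
  | empty => simp
  | insert i S hi ih =>
    rw [Finset.prod_insert hi, Finset.sum_insert hi]
    have h1 := sgn_le_one hq (z i)
    have h2 := abs_le.1 (abs_prod_sgn_le_one hq S z)
    nlinarith

/-- A nonnegative symmetric weight of mean `1`, depending only on the zero pattern. -/
structure IsWeight (w : (Fin n → Fin q) → ℝ) : Prop where
  nonneg : ∀ z, 0 ≤ w z
  avg_eq : avg w = 1
  pattern : PatternDep w
  symm : Symm w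

lemma IsWeight.eig_empty {w : (Fin n → Fin q) → ℝ} (hw : IsWeight w) : eig w ∅ = 1 := by
  simpa [eig] using hw.avg_eq

lemma IsWeight.eig_le_one {w : (Fin n → Fin q) → ℝ} (hw : IsWeight w) (hq : 2 ≤ q)
    (S : Finset (Fin n)) : eig w S ≤ 1 := by
  rw [← hw.avg_eq]
  apply avg_mono
  intro z
  exact mul_le_of_le_one_right (hw.nonneg z) (abs_le.1 (abs_prod_sgn_le_one hq S z)).2

/-- Averages `one_sub_prod_sgn_le` against w; by symmetry all singletons contribute equally. It
reduces every eigenvalue to the first. -/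
lemma IsWeight.one_sub_eig_le {w : (Fin n → Fin q) → ℝ} (hw : IsWeight w) (hq : 2 ≤ q)
    (S : Finset (Fin n)) (i : Fin n) : 1 - eig w S ≤ S.card * (1 - eig w {i}) := by
  have h1 : 1 - eig w S = avg (fun z => w z * (1 - ∏ i ∈ S, sgn (z i))) := by
    simp only [mul_sub, avg_sub, mul_one, eig]
    rw [← hw.avg_eq]
  have h2 : (S.card : ℝ) * (1 - eig w {i}) = avg (fun z => w z * ∑ i ∈ S, (1 - sgn (z i))) := by
    simp only [Finset.mul_sum, avg_sum, mul_sub, mul_one, avg_sub]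
    have h3 : ∀ j, avg w - avg (fun z => w z * sgn (z j)) = 1 - eig w {i} := by
      intro j
      rw [eig_eq_of_card hw.symm (show ({i} : Finset (Fin n)).card = ({j} : Finset (Fin n)).card by
        simp), hw.avg_eq]
      simp [eig]
    simp only [h3, Finset.sum_const, nsmul_eq_mul]
    ring
  rw [h1, h2]
  apply avg_mono
  intro z
  exact mul_le_mul_of_nonneg_left (one_sub_prod_sgn_le hq S z) (hw.nonneg z)

/-! ### Eigenvalues and moments of the mean of `sgn` -/

/-- The mean of `sgn` over the coordinates. -/
def meanSgn (z : Fin n → Fin q) : ℝ := (1 / (n : ℝ)) * ∑ i, sgn (z i)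

lemma abs_meanSgn_le_one (hq : 2 ≤ q) (z : Fin n → Fin q) : |meanSgn z| ≤ 1 := by
  have h : |∑ i, sgn (z i)| ≤ n := by
    refine (Finset.abs_sum_le_sum_abs _ _).trans ?_
    refine (Finset.sum_le_sum fun i _ => abs_sgn_le_one hq (z i)).trans ?_
    simp
  rw [meanSgn, abs_mul, abs_of_nonneg (by positivity : (0 : ℝ) ≤ 1 / n), one_div_mul_eq_div]
  exact div_le_one_of_le₀ h (by positivity)

lemma neg_inv_le_meanSgn (hq : 2 ≤ q) (z : Fin n → Fin q) :
    -(1 / ((q : ℝ) - 1)) ≤ meanSgn z := by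
  have hq' : (2 : ℝ) ≤ q := by exact_mod_cast hq
  have hpos : (0 : ℝ) ≤ 1 / ((q : ℝ) - 1) := by
    apply div_nonneg <;> linarith
  have h : ∑ i : Fin n, -(1 / ((q : ℝ) - 1)) ≤ ∑ i, sgn (z i) :=
    Finset.sum_le_sum fun i _ => neg_inv_le_sgn hq (z i)
  rw [Finset.sum_const, Finset.card_univ, Fintype.card_fin, nsmul_eq_mul] at h
  rw [meanSgn]
  rcases Nat.eq_zero_or_pos n with hn | hn
  · subst hn; simpa using hpos
  · have hn' : (0 : ℝ) < n := by exact_mod_cast hn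
    rw [one_div_mul_eq_div, le_div_iff₀ hn']
    linarith

lemma symm_meanSgn : Symm (meanSgn : (Fin n → Fin q) → ℝ) := fun σ z => by
  simp only [meanSgn, Function.comp]
  rw [Equiv.sum_comp σ (fun i => sgn (z i))]

/-- Multiplying the weight by the mean of `sgn` amounts to adding an element to `S`, up to an
error of order `1 / n`. -/
lemma eig_mul_meanSgn_le (hq : 2 ≤ q) {w : (Fin n → Fin q) → ℝ} (hw : Symm w)
    (hb : avg (fun z => |w z|) ≤ 1) {S T : Finset (Fin n)} (hT : T.card = S.card + 1) :
    eig (fun z => w z * meanSgn z) S ≤ eig w T + 2 * S.card / n := by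
  have hn : (0 : ℝ) < n := by
    have : T.card ≤ n := by simpa using Finset.card_le_univ T
    exact_mod_cast (by omega : 0 < n)
  have h1 : eig (fun z => w z * meanSgn z) S =
      (1 / (n : ℝ)) * ∑ i, avg (fun z => w z * (sgn (z i) * ∏ j ∈ S, sgn (z j))) := by
    rw [← avg_sum, ← avg_const_mul, eig]
    congr 1
    ext z
    simp only [meanSgn, ← Finset.mul_sum, ← Finset.sum_mul]
    ring
  -- Only the indices i ∈ S, a fraction |S|/n, fail to enlarge S; there both averages lie in [-1,
  -- 1], so the loss is at most 2.
  have h2 : ∀ i, avg (fun z => w z * (sgn (z i) * ∏ j ∈ S, sgn (z j))) ≤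
      eig w T + if i ∈ S then 2 else 0 := by
    intro i
    split_ifs with hi
    · have h3 := abs_le.1 (abs_avg_mul_le hb (v := fun z => sgn (z i) * ∏ j ∈ S, sgn (z j))
        fun z => by
          rw [abs_mul]
          exact mul_le_one₀ (abs_sgn_le_one hq _) (abs_nonneg _) (abs_prod_sgn_le_one hq S z))
      have h4 := abs_le.1 (abs_avg_mul_le hb (abs_prod_sgn_le_one hq T))
      have h5 : eig w T = avg (fun z => w z * ∏ i ∈ T, sgn (z i)) := rfl
      linarith [h3.2, h4.1]
    · rw [add_zero, ← eig_eq_of_card hw (S := insert i S) (by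
        rw [Finset.card_insert_of_notMem hi, hT]), eig]
      simp only [Finset.prod_insert hi, le_refl]
  have h3 := Finset.sum_le_sum fun i (_ : i ∈ Finset.univ) => h2 i
  rw [Finset.sum_add_distrib, Finset.sum_const, Finset.card_univ, Fintype.card_fin,
    nsmul_eq_mul, Finset.sum_ite_mem, Finset.univ_inter, Finset.sum_const, nsmul_eq_mul] at h3
  rw [h1, one_div_mul_eq_div, div_le_iff₀ hn, add_mul, div_mul_cancel₀ _ hn.ne']
  linarith

lemma eig_mul_meanSgn_pow_le (hq : 2 ≤ q) {w : (Fin n → Fin q) → ℝ} (hw : Symm w)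
    (hb : avg (fun z => |w z|) ≤ 1) (j : ℕ) {S T : Finset (Fin n)}
    (hT : T.card = S.card + j) :
    eig (fun z => w z * meanSgn z ^ j) S ≤ eig w T + 2 * j * (S.card + j) / n := by
  induction j generalizing S with
  | zero => simp [eig_eq_of_card hw (show S.card = T.card by omega)]
  | succ j ih =>
    obtain ⟨S', hS'⟩ : ∃ S' : Finset (Fin n), S'.card = S.card + 1 := by
      obtain ⟨S', -, h⟩ := Finset.exists_subset_card_eq (show S.card + 1 ≤ T.card by omega)
      exact ⟨S', h⟩
    have hsymm : ∀ j : ℕ, Symm (fun z : Fin n → Fin q => meanSgn z ^ j) := fun j σ z => by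
      simp only [symm_meanSgn σ z]
    have h1 := eig_mul_meanSgn_le hq (hw.mul (hsymm j)) (by
      refine le_trans (avg_mono fun z => ?_) hb
      rw [abs_mul, abs_pow]
      exact mul_le_of_le_one_right (abs_nonneg _)
        (pow_le_one₀ (abs_nonneg _) (abs_meanSgn_le_one hq z))) hS'
    have h2 := ih (S := S') (by omega)
    have h3 : (fun z : Fin n → Fin q => w z * meanSgn z ^ (j + 1)) =
        fun z => w z * meanSgn z ^ j * meanSgn z := by
      ext z; ring
    rw [h3]
    refine h1.trans ?_
    have h4 : 2 * (j : ℝ) * (S'.card + j) / n + 2 * S.card / n ≤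
        2 * ((j + 1 : ℕ) : ℝ) * (S.card + (j + 1 : ℕ)) / n := by
      rw [← add_div, hS']
      gcongr
      push_cast
      nlinarith [Nat.cast_nonneg (α := ℝ) j, Nat.cast_nonneg (α := ℝ) S.card]
    linarith

lemma IsWeight.avg_mul_meanSgn {w : (Fin n → Fin q) → ℝ} (hw : IsWeight w) (i : Fin n) :
    avg (fun z => w z * meanSgn z) = eig w {i} := by
  have hn : (n : ℝ) ≠ 0 := Nat.cast_ne_zero.2 (by have := i.2; omega)
  have h : ∀ j, avg (fun z => w z * sgn (z j)) = eig w {i} := fun j => by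
    rw [eig_eq_of_card hw.symm (show ({i} : Finset (Fin n)).card = ({j} : Finset (Fin n)).card by
      simp)]
    simp [eig]
  have h2 : (fun z : Fin n → Fin q => w z * meanSgn z) =
      fun z => (1 / (n : ℝ)) * ∑ j, w z * sgn (z j) := by
    ext z
    rw [meanSgn, ← Finset.mul_sum]
    ring
  rw [h2, avg_const_mul, avg_sum]
  simp [h, hn]

/-- For `q ≥ 3`, if the first eigenvalue is at least `1 / 2`, then the other ones are bounded
below, up to an error of order `1 / n`. -/
lemma IsWeight.le_eig_of_three_le {w : (Fin n → Fin q) → ℝ} (hw : IsWeight w) (hq : 3 ≤ q)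
    (i : Fin n) (h : 1 / 2 ≤ eig w {i}) (T : Finset (Fin n)) :
    (1 / 2) ^ T.card - 2 * (T.card : ℝ) ^ 2 / n ≤ eig w T := by
  have hq2 : 2 ≤ q := by omega
  have hb : avg (fun z => |w z|) ≤ 1 := by
    simp only [abs_of_nonneg (hw.nonneg _)]
    exact hw.avg_eq.le
  set k := T.card with hk
  have h1 := eig_mul_meanSgn_pow_le hq2 hw.symm hb k (S := ∅) (T := T) (by simp [hk])
  have h2 : (1 / 2) ^ k ≤ eig (fun z => w z * meanSgn z ^ k) ∅ := by
    -- Tangent line at 1/2: X^k ≥ (1/2)^k (1 + k (2X - 1)). Bernoulli's inequality needs 2X - 1 ≥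
    -- -2, that is X ≥ -1/2, which holds because q ≥ 3.
    have h3 : ∀ z : Fin n → Fin q,
        w z * ((1 / 2) ^ k * (1 - k)) + (1 / 2) ^ k * (2 * k) * (w z * meanSgn z) ≤
          w z * meanSgn z ^ k := by
      intro z
      have hX : -(1 / 2) ≤ meanSgn z := by
        refine le_trans ?_ (neg_inv_le_meanSgn hq2 z)
        have : (3 : ℝ) ≤ q := by exact_mod_cast hq
        rw [neg_le_neg_iff]
        apply one_div_le_one_div_of_le <;> linarith
      have h4 := one_add_mul_le_pow (a := 2 * meanSgn z - 1) (by linarith) k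
      have h5 : meanSgn z ^ k = (1 / 2) ^ k * (1 + (2 * meanSgn z - 1)) ^ k := by
        rw [← mul_pow]; congr 1; ring
      have h6 : (1 / 2) ^ k * (1 - (k : ℝ)) + (1 / 2) ^ k * (2 * k) * meanSgn z ≤
          meanSgn z ^ k := by
        rw [h5]
        refine le_trans (le_of_eq ?_) (mul_le_mul_of_nonneg_left h4 (by positivity))
        ring
      nlinarith [mul_le_mul_of_nonneg_left h6 (hw.nonneg z)]
    have h4 := avg_mono h3
    rw [avg_add, avg_mul_const, avg_const_mul, hw.avg_eq, hw.avg_mul_meanSgn i] at h4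
    simp only [eig, Finset.prod_empty, mul_one]
    refine le_trans ?_ h4
    have : (0 : ℝ) ≤ (1 / 2) ^ k * k := by positivity
    nlinarith
  simp only [Finset.card_empty, Nat.cast_zero, zero_add] at h1
  have : 2 * (k : ℝ) * k / n = 2 * (k : ℝ) ^ 2 / n := by ring
  linarith

end

/-! ### Symmetric kernels and the first eigenvalue of their squares -/

section

variable {q n : ℕ} [NeZero q]

/-- The symmetric kernel with coefficient `ν k` at the kernels of the sets of size `k`. -/
def rad (ν : ℕ → ℝ) (z : Fin n → Fin q) : ℝ := ∑ S : Finset (Fin n), ν S.card * ker S z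

lemma patternDep_rad (ν : ℕ → ℝ) : PatternDep (rad ν : (Fin n → Fin q) → ℝ) := by
  intro z z' h
  refine Finset.sum_congr rfl fun S _ => ?_
  congr 1
  exact Finset.prod_congr rfl fun i _ => gen_eq_of_iff (h i)

lemma symm_rad (ν : ℕ → ℝ) : Symm (rad ν : (Fin n → Fin q) → ℝ) := by
  intro σ z
  refine Fintype.sum_equiv (Equiv.finsetCongr σ) _ _ fun S => ?_
  simp [ker]

lemma avg_rad_mul_ker (ν : ℕ → ℝ) (T : Finset (Fin n)) :
    avg (fun z : Fin n → Fin q => rad ν z * ker T z) = ν T.card * ((q : ℝ) - 1) ^ T.card := by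
  simp only [rad, Finset.sum_mul, avg_sum, mul_assoc, avg_const_mul, avg_ker_mul_ker]
  simp

lemma sum_apply_card (F : ℕ → ℝ) :
    ∑ S : Finset (Fin n), F S.card = ∑ k ∈ Finset.range (n + 1), (n.choose k : ℝ) * F k := by
  have := Finset.sum_powerset_apply_card F (x := (Finset.univ : Finset (Fin n)))
  simpa using this

lemma avg_rad_mul_self (ν : ℕ → ℝ) :
    avg (fun z : Fin n → Fin q => rad ν z * rad ν z) =
      ∑ k ∈ Finset.range (n + 1), (n.choose k : ℝ) * (((q : ℝ) - 1) ^ k * ν k ^ 2) := by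
  have h : avg (fun z : Fin n → Fin q => rad ν z * rad ν z) =
      ∑ S : Finset (Fin n), ν S.card * avg (fun z : Fin n → Fin q => rad ν z * ker S z) := by
    simp only [← avg_const_mul, ← avg_sum]
    congr 1
    ext z
    have : rad ν z * rad ν z = (∑ S : Finset (Fin n), ν S.card * ker S z) * rad ν z := rfl
    rw [this, Finset.sum_mul]
    exact Finset.sum_congr rfl fun S _ => by ring
  rw [h, ← sum_apply_card]
  refine Finset.sum_congr rfl fun S _ => ?_
  rw [avg_rad_mul_ker]; ring

/-- If i ∉ S, the factor `gen (z i)` enlarges S by i; if i ∈ S, `gen_sq` splits the product into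
`ker S` and `ker (S.erase i)`. -/
lemma avg_rad_mul_ker_mul_gen (ν : ℕ → ℝ) (S : Finset (Fin n)) (i : Fin n) :
    avg (fun z : Fin n → Fin q => rad ν z * (ker S z * gen (z i))) =
      if i ∈ S then ((q : ℝ) - 2) * ν S.card * (q - 1) ^ S.card +
        ν (S.card - 1) * (q - 1) ^ S.card
      else ν (S.card + 1) * ((q : ℝ) - 1) ^ (S.card + 1) := by
  split_ifs with hi
  · have h1 : ∀ z : Fin n → Fin q, rad ν z * (ker S z * gen (z i)) =
        ((q : ℝ) - 2) * (rad ν z * ker S z) + (q - 1) * (rad ν z * ker (S.erase i) z) := by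
      intro z
      have h2 : ker S z = gen (z i) * ker (S.erase i) z :=
        (Finset.mul_prod_erase S (fun i => gen (z i)) hi).symm
      rw [h2]
      linear_combination (rad ν z * ker (S.erase i) z) * gen_sq (z i)
    have hc : S.card = (S.card - 1) + 1 := by
      have := Finset.card_pos.2 ⟨i, hi⟩
      omega
    simp only [h1, avg_add, avg_const_mul, avg_rad_mul_ker, Finset.card_erase_of_mem hi]
    have h3 : ((q : ℝ) - 1) ^ S.card = (q - 1) ^ (S.card - 1) * (q - 1) := by
      rw [← pow_succ, ← hc]
    rw [h3]; ring
  · rw [← Finset.card_insert_of_notMem hi, ← avg_rad_mul_ker]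
    congr 1
    ext z
    simp only [ker, Finset.prod_insert hi]
    ring

/-- Multiplication by the sum of `gen` is tridiagonal in the level k. The raising and lowering terms
agree by the recursion for binomial coefficients, whence the factor 2. -/
lemma avg_rad_mul_rad_mul_sum_gen (ν : ℕ → ℝ) :
    avg (fun z : Fin n → Fin q => rad ν z * rad ν z * ∑ i, gen (z i)) =
      ∑ k ∈ Finset.range (n + 1),
        (n.choose k : ℝ) * (((q : ℝ) - 1) ^ k * ((q - 2) * k * ν k ^ 2)) +
      2 * ∑ k ∈ Finset.range n,
        (n.choose k : ℝ) * (((q : ℝ) - 1) ^ (k + 1) * ((n - k) * (ν k * ν (k + 1)))) := by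
  have h1 : avg (fun z : Fin n → Fin q => rad ν z * rad ν z * ∑ i, gen (z i)) =
      ∑ S : Finset (Fin n), ν S.card *
        ∑ i, avg (fun z : Fin n → Fin q => rad ν z * (ker S z * gen (z i))) := by
    simp only [← avg_const_mul, ← avg_sum]
    congr 1
    ext z
    have : rad ν z * rad ν z * ∑ i, gen (z i) =
        (∑ S : Finset (Fin n), ν S.card * ker S z) * (rad ν z * ∑ i, gen (z i)) := by
      rw [rad]; ring
    rw [this, Finset.sum_mul]
    refine Finset.sum_congr rfl fun S _ => ?_
    simp only [← Finset.mul_sum]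
    ring
  have h2 : ∀ S : Finset (Fin n),
      ∑ i, avg (fun z : Fin n → Fin q => rad ν z * (ker S z * gen (z i))) =
        S.card * (((q : ℝ) - 2) * ν S.card * (q - 1) ^ S.card +
          ν (S.card - 1) * (q - 1) ^ S.card) +
        (n - S.card) * (ν (S.card + 1) * ((q : ℝ) - 1) ^ (S.card + 1)) := by
    intro S
    simp only [avg_rad_mul_ker_mul_gen]
    rw [Finset.sum_ite]
    simp only [Finset.sum_const, nsmul_eq_mul]
    have hc : ((Finset.univ.filter fun i => i ∉ S).card : ℝ) = n - S.card := by
      have : (Finset.univ.filter fun i => i ∉ S) = Sᶜ := by ext; simp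
      rw [this, Finset.card_compl, Nat.cast_sub (Finset.card_le_univ S)]
      simp
    rw [hc]
    simp
  simp only [h1, h2]
  rw [sum_apply_card (fun k => ν k * (k * (((q : ℝ) - 2) * ν k * (q - 1) ^ k +
          ν (k - 1) * (q - 1) ^ k) +
        (n - k) * (ν (k + 1) * ((q : ℝ) - 1) ^ (k + 1))))]
  have h3 : ∑ k ∈ Finset.range (n + 1), (n.choose k : ℝ) * (ν k * (k * (ν (k - 1) *
      ((q : ℝ) - 1) ^ k))) = ∑ k ∈ Finset.range n,
        (n.choose k : ℝ) * (((q : ℝ) - 1) ^ (k + 1) * ((n - k) * (ν k * ν (k + 1)))) := by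
    rw [Finset.sum_range_succ']
    simp only [Nat.cast_zero, zero_mul, mul_zero, add_zero, Nat.add_sub_cancel]
    refine Finset.sum_congr rfl fun k hk => ?_
    have h4 : (n.choose (k + 1) : ℝ) * (k + 1 : ℕ) = n.choose k * (n - k) := by
      rw [← Nat.cast_sub (Finset.mem_range.1 hk).le]
      exact_mod_cast Nat.choose_succ_right_eq n k
    linear_combination (ν (k + 1) * ν k * ((q : ℝ) - 1) ^ (k + 1)) * h4
  have h5 : ∑ k ∈ Finset.range (n + 1), (n.choose k : ℝ) * (ν k * ((n - k) * (ν (k + 1) *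
      ((q : ℝ) - 1) ^ (k + 1)))) = ∑ k ∈ Finset.range n,
        (n.choose k : ℝ) * (((q : ℝ) - 1) ^ (k + 1) * ((n - k) * (ν k * ν (k + 1)))) := by
    rw [Finset.sum_range_succ, sub_self]
    simp only [zero_mul, mul_zero, add_zero]
    exact Finset.sum_congr rfl fun k _ => by ring
  rw [two_mul]
  nth_rewrite 1 [← h3]
  rw [← h5, ← Finset.sum_add_distrib, ← Finset.sum_add_distrib]
  exact Finset.sum_congr rfl fun k _ => by ring

/-- A kernel of degree at most `a + l` whose square is concentrated near `0`. -/
lemma exists_rad (hq : 2 ≤ q) {a l : ℕ} (h : a + l ≤ n) : ∃ ν : ℕ → ℝ,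
    (∀ k, a + l < k → ν k = 0) ∧
    avg (fun z : Fin n → Fin q => rad ν z * rad ν z) = 1 ∧
    ((q : ℝ) - 2) * a + 2 * (l / (l + 1)) * √((q - 1) * a * (n - a - l)) ≤
      avg (fun z : Fin n → Fin q => rad ν z * rad ν z * ∑ i, gen (z i)) := by
  have hq' : (2 : ℝ) ≤ q := by exact_mod_cast hq
  have hq1 : (0 : ℝ) < q - 1 := by linarith
  set N : ℕ → ℝ := fun k => n.choose k * ((q : ℝ) - 1) ^ k with hN
  have hNpos : ∀ k, k ≤ n → 0 < N k := fun k hk => by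
    have : (0 : ℝ) < n.choose k := by exact_mod_cast Nat.choose_pos hk
    positivity
  -- N k is the squared norm of the sum of `ker S` over |S| = k, so each of the l + 1 levels of the
  -- window carries mass 1/(l + 1).
  set ν : ℕ → ℝ := fun k => if k ∈ Finset.Icc a (a + l) then 1 / √((l + 1) * N k) else 0 with hν
  have hν0 : ∀ k, 0 ≤ ν k := fun k => by
    simp only [hν]; split_ifs <;> positivity
  have hsub : Finset.Icc a (a + l) ⊆ Finset.range (n + 1) := fun k hk => by
    simp only [Finset.mem_Icc, Finset.mem_range] at hk ⊢; omega
  have hνsq : ∀ k ∈ Finset.Icc a (a + l), N k * ν k ^ 2 = 1 / (l + 1) := fun k hk => by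
    have hk' := hNpos k (by simp only [Finset.mem_Icc] at hk; omega)
    simp only [hν, hk, if_true]
    rw [div_pow, Real.sq_sqrt (by positivity)]
    field_simp
  refine ⟨ν, fun k hk => ?_, ?_, ?_⟩
  · simp only [hν, Finset.mem_Icc]
    rw [if_neg (by omega)]
  · rw [avg_rad_mul_self, ← Finset.sum_subset hsub]
    · rw [Finset.sum_congr rfl fun k hk => (mul_assoc _ _ _).symm.trans (hνsq k hk)]
      simp only [Finset.sum_const, Nat.card_Icc, nsmul_eq_mul]
      have : a + l + 1 - a = l + 1 := by omega
      rw [this]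
      push_cast
      field_simp
    · intro k _ hk
      simp only [hν, if_neg hk]
      simp
  · rw [avg_rad_mul_rad_mul_sum_gen]
    have hl : (0 : ℝ) < l + 1 := by positivity
    have h1 : ((q : ℝ) - 2) * a ≤ ∑ k ∈ Finset.range (n + 1),
        (n.choose k : ℝ) * (((q : ℝ) - 1) ^ k * ((q - 2) * k * ν k ^ 2)) := by
      refine le_trans ?_ (Finset.sum_le_sum_of_subset_of_nonneg hsub fun k _ _ => ?_)
      · have h2 : ∀ k ∈ Finset.Icc a (a + l), ((q : ℝ) - 2) * a / (l + 1) ≤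
            (n.choose k : ℝ) * (((q : ℝ) - 1) ^ k * ((q - 2) * k * ν k ^ 2)) := by
          intro k hk
          have h3 : (n.choose k : ℝ) * (((q : ℝ) - 1) ^ k * ((q - 2) * k * ν k ^ 2)) =
              (q - 2) * k / (l + 1) := by
            have := hνsq k hk
            simp only [hN] at this
            linear_combination ((q : ℝ) - 2) * k * this
          rw [h3]
          have : (a : ℝ) ≤ k := by exact_mod_cast (Finset.mem_Icc.1 hk).1
          have : (0 : ℝ) ≤ q - 2 := by linarith
          gcongr
        refine le_trans (le_of_eq ?_) (Finset.card_nsmul_le_sum _ _ _ h2)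
        have : a + l + 1 - a = l + 1 := by omega
        rw [Nat.card_Icc, this, nsmul_eq_mul]
        push_cast
        field_simp
      · have : (0 : ℝ) ≤ q - 2 := by linarith
        have : 0 ≤ ν k := hν0 k
        positivity
    -- The window has only l adjacent pairs of levels. The pair k, k + 1 contributes
    -- √((q-1)(k+1)(n-k)) / (l+1).
    have h2 : (l / (l + 1)) * √((q - 1) * a * (n - a - l)) ≤ ∑ k ∈ Finset.range n,
        (n.choose k : ℝ) * (((q : ℝ) - 1) ^ (k + 1) * ((n - k) * (ν k * ν (k + 1)))) := by
      have hsub' : Finset.Ico a (a + l) ⊆ Finset.range n := fun k hk => by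
        simp only [Finset.mem_Ico, Finset.mem_range] at hk ⊢; omega
      refine le_trans ?_ (Finset.sum_le_sum_of_subset_of_nonneg hsub' fun k hk _ => ?_)
      · have h3 : ∀ k ∈ Finset.Ico a (a + l), √((q - 1) * a * (n - a - l)) / (l + 1) ≤
            (n.choose k : ℝ) * (((q : ℝ) - 1) ^ (k + 1) * ((n - k) * (ν k * ν (k + 1)))) := by
          intro k hk
          have hk' := Finset.mem_Ico.1 hk
          have hkn : (k : ℝ) + 1 ≤ n := by exact_mod_cast (by omega : k + 1 ≤ n)
          have hak : (a : ℝ) ≤ k := by exact_mod_cast hk'.1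
          have hkl : (k : ℝ) ≤ a + l := by exact_mod_cast hk'.2.le
          have hP := hNpos k (by omega)
          have hQ := hNpos (k + 1) (by omega)
          have hrec : N (k + 1) * (k + 1) = N k * ((q - 1) * (n - k)) := by
            have h4 : (n.choose (k + 1) : ℝ) * (k + 1) = n.choose k * (n - k) := by
              rw [← Nat.cast_sub (by omega : k ≤ n)]
              exact_mod_cast Nat.choose_succ_right_eq n k
            simp only [hN, pow_succ]
            linear_combination ((q : ℝ) - 1) ^ k * (q - 1) * h4
          have hm1 : k ∈ Finset.Icc a (a + l) := Finset.mem_Icc.2 (by omega)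
          have hm2 : k + 1 ∈ Finset.Icc a (a + l) := Finset.mem_Icc.2 (by omega)
          have hterm : (n.choose k : ℝ) * (((q : ℝ) - 1) ^ (k + 1) *
              ((n - k) * (ν k * ν (k + 1)))) =
              N k * ((q - 1) * (n - k)) / (√(N k) * √(N (k + 1))) / (l + 1) := by
            simp only [hν, hm1, hm2, if_true]
            rw [Real.sqrt_mul hl.le, Real.sqrt_mul hl.le]
            have h5 : √((l : ℝ) + 1) * √((l : ℝ) + 1) = l + 1 := Real.mul_self_sqrt hl.le
            have h6 : 1 / (√((l : ℝ) + 1) * √(N k)) * (1 / (√((l : ℝ) + 1) * √(N (k + 1)))) =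
                1 / (√(N k) * √(N (k + 1)) * (l + 1)) := by
              rw [div_mul_div_comm, one_mul]
              congr 1
              linear_combination √(N k) * √(N (k + 1)) * h5
            rw [h6, pow_succ]
            simp only [hN]
            field_simp
          rw [hterm]
          refine div_le_div_of_nonneg_right ?_ hl.le
          rw [← Real.sqrt_mul hP.le, le_div_iff₀ (Real.sqrt_pos.2 (by positivity)),
            ← Real.sqrt_mul' _ (by positivity)]
          have hnk : (0 : ℝ) ≤ n - k := by linarith
          refine Real.sqrt_le_iff.2 ⟨by positivity, ?_⟩
          have h7 : (N k * ((q - 1) * (n - k))) ^ 2 =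
              ((q - 1) * (k + 1) * (n - k)) * (N k * N (k + 1)) := by
            linear_combination (-(N k * ((q - 1) * (n - k)))) * hrec
          rw [h7]
          refine mul_le_mul_of_nonneg_right ?_ (by positivity)
          have h8 : (n : ℝ) - a - l ≤ n - k := by linarith
          calc ((q : ℝ) - 1) * a * (n - a - l) ≤ (q - 1) * a * (n - k) := by gcongr
            _ ≤ (q - 1) * (k + 1) * (n - k) := by gcongr; linarith
        refine le_trans (le_of_eq ?_) (Finset.card_nsmul_le_sum _ _ _ h3)
        rw [Nat.card_Ico, Nat.add_sub_cancel_left, nsmul_eq_mul]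
        ring
      · have hk' : (k : ℝ) ≤ n := by exact_mod_cast (Finset.mem_range.1 hk).le
        have h3 : (0 : ℝ) ≤ n - k := by linarith
        have := hν0 k
        have := hν0 (k + 1)
        positivity
    linarith

/-- The square of a normalized symmetric kernel is a weight. -/
lemma isWeight_rad {ν : ℕ → ℝ}
    (h : avg (fun z : Fin n → Fin q => rad ν z * rad ν z) = 1) :
    IsWeight (fun z : Fin n → Fin q => rad ν z * rad ν z) where
  nonneg z := mul_self_nonneg _
  avg_eq := h
  pattern z z' hz := by simp only [patternDep_rad ν z z' hz]
  symm := (symm_rad ν).mul (symm_rad ν)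

lemma eig_singleton_rad {ν : ℕ → ℝ}
    (h : avg (fun z : Fin n → Fin q => rad ν z * rad ν z) = 1) (i : Fin n) :
    eig (fun z : Fin n → Fin q => rad ν z * rad ν z) {i} =
      1 / (n * ((q : ℝ) - 1)) *
        avg (fun z : Fin n → Fin q => rad ν z * rad ν z * ∑ i, gen (z i)) := by
  rw [← (isWeight_rad h).avg_mul_meanSgn i, ← avg_const_mul]
  congr 1
  ext z
  simp only [meanSgn, sgn, ← Finset.sum_div]
  rw [one_div_mul_eq_div, one_div_mul_eq_div, div_div, mul_div_assoc', mul_comm (n : ℝ)]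

/-! ### Polynomials representing the kernels -/

lemma exists_polynomial_gen (b : Fin q) : ∃ P : Polynomial ℝ, P.natDegree ≤ q - 1 ∧
    ∀ c : Fin q, P.eval ((c : ℕ) : ℝ) = gen (c - b) := by
  have hinj : Set.InjOn (fun c : Fin q => ((c : ℕ) : ℝ)) (Finset.univ : Finset (Fin q)) := by
    intro c _ c' _ h
    exact Fin.ext (Nat.cast_injective h)
  refine ⟨Lagrange.interpolate Finset.univ (fun c : Fin q => ((c : ℕ) : ℝ))
    (fun c => gen (c - b)), ?_, fun c => ?_⟩
  · have := Lagrange.degree_interpolate_le (r := fun c : Fin q => gen (c - b)) hinj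
    simpa using Polynomial.natDegree_le_of_degree_le this
  · exact Lagrange.eval_interpolate_at_node _ hinj (Finset.mem_univ c)

/-- On the cube, a symmetric kernel is given by polynomials of low degree. -/
lemma exists_mvPolynomial_rad {ν : ℕ → ℝ} {r : ℕ} (hν : ∀ k, r < k → ν k = 0)
    (y : Fin n → Fin q) : ∃ p : MvPolynomial (Fin n) ℝ, p.totalDegree ≤ (q - 1) * r ∧
      ∀ x : Fin n → Fin q, value p x = rad ν (x - y) := by
  choose P hP hPe using fun b : Fin q => exists_polynomial_gen b
  have hdeg : ∀ i b, (Polynomial.aeval (MvPolynomial.X i : MvPolynomial (Fin n) ℝ)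
      (P b)).totalDegree ≤ q - 1 := by
    intro i b
    rw [Polynomial.aeval_eq_sum_range]
    refine MvPolynomial.totalDegree_finsetSum_le fun k hk => ?_
    refine (MvPolynomial.totalDegree_smul_le _ _).trans ?_
    rw [MvPolynomial.totalDegree_X_pow]
    have := Finset.mem_range.1 hk
    have := hP b
    omega
  refine ⟨∑ S : Finset (Fin n), MvPolynomial.C (ν S.card) *
    ∏ i ∈ S, Polynomial.aeval (MvPolynomial.X i) (P (y i)), ?_, fun x => ?_⟩
  · refine MvPolynomial.totalDegree_finsetSum_le fun S _ => ?_
    by_cases hS : r < S.card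
    · simp [hν _ hS]
    · refine (MvPolynomial.totalDegree_mul _ _).trans ?_
      rw [MvPolynomial.totalDegree_C, zero_add]
      refine (MvPolynomial.totalDegree_finsetProd _ _).trans ?_
      refine (Finset.sum_le_card_nsmul _ _ _ fun i _ => hdeg i (y i)).trans ?_
      rw [smul_eq_mul, mul_comm]
      exact Nat.mul_le_mul_left _ (not_lt.1 hS)
  · simp only [value, map_sum, map_mul, MvPolynomial.eval_C, map_prod, rad, ker]
    refine Finset.sum_congr rfl fun S _ => ?_
    congr 1
    refine Finset.prod_congr rfl fun i _ => ?_
    rw [Pi.sub_apply, ← hPe]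
    rw [Polynomial.aeval_def, Polynomial.hom_eval₂, MvPolynomial.eval_X]
    rw [Polynomial.eval, Polynomial.eval₂_eq_sum, Polynomial.eval₂_eq_sum]
    simp

end

/-! ### Errors of the two bounds in terms of eigenvalues -/

section

variable {q n : ℕ}

lemma isSOS_sum {ι : Type*} [Fintype ι] {r : ℕ} {p : ι → MvPolynomial (Fin n) ℝ}
    (hp : ∀ i, (p i).totalDegree ≤ r) : IsSOS r (∑ i, p i ^ 2) := by
  refine ⟨Fintype.card ι, fun k => p ((Fintype.equivFin ι).symm k), fun k => hp _, ?_⟩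
  exact (Equiv.sum_comp (Fintype.equivFin ι).symm (fun i => p i ^ 2)).symm

lemma abs_value_le_supNorm (f : MvPolynomial (Fin n) ℝ) (x : Fin n → Fin q) :
    |value f x| ≤ supNorm q f :=
  le_ciSup (f := fun x : Fin n → Fin q => |value f x|) (Set.finite_range _).bddAbove x

lemma minValue_le (f : MvPolynomial (Fin n) ℝ) (x : Fin n → Fin q) :
    minValue q f ≤ value f x :=
  ciInf_le (Set.finite_range _).bddBelow x

variable [NeZero q]

lemma exists_value_eq_minValue (f : MvPolynomial (Fin n) ℝ) :
    ∃ x : Fin n → Fin q, value f x = minValue q f :=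
  exists_eq_ciInf_of_finite

/-- The eigenvalues of a weight as a function of the cardinality. -/
lemma IsWeight.exists_eig_eq {w : (Fin n → Fin q) → ℝ} (hw : IsWeight w) :
    ∃ c : ℕ → ℝ, (∀ S, eig w S = c S.card) ∧ ∀ k, ∃ S, S.card ≤ k ∧ c k = eig w S := by
  have hcard : ∀ k, (Finset.univ.filter fun i : Fin n => (i : ℕ) < k).card ≤ k := fun k => by
    simp [Fin.card_filter_val_lt]
  -- For k > n the set is everything, so c k is still an eigenvalue of a set of size at most k; D
  -- may exceed n.
  refine ⟨fun k => eig w (Finset.univ.filter fun i : Fin n => (i : ℕ) < k), fun S => ?_,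
    fun k => ⟨_, hcard k, rfl⟩⟩
  refine eig_eq_of_card hw.symm ?_
  have : S.card ≤ n := by simpa using Finset.card_le_univ S
  simp [Fin.card_filter_val_lt, this]

/-- A sum of levels with small coefficients is small. -/
lemma abs_sum_mul_level_le {f : (Fin n → Fin q) → ℝ} {D : ℕ} {γ : ℝ}
    (hf : ∀ k ∈ Finset.range (D + 1), ∀ x, |level f k x| ≤ γ) {c : ℕ → ℝ} {δ : ℝ} (hδ : 0 ≤ δ)
    (hc : ∀ k ∈ Finset.range (D + 1), |c k| ≤ k * δ) (x : Fin n → Fin q) :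
    |∑ k ∈ Finset.range (D + 1), c k * level f k x| ≤ γ * (D + 1) * D * δ := by
  have h : ∀ k ∈ Finset.range (D + 1), |c k * level f k x| ≤ D * δ * γ := by
    intro k hk
    have hk' : (k : ℝ) ≤ D := by exact_mod_cast Nat.lt_succ_iff.1 (Finset.mem_range.1 hk)
    rw [abs_mul]
    refine mul_le_mul ((hc k hk).trans ?_) (hf k hk x) (abs_nonneg _) (by positivity)
    gcongr
  refine (Finset.abs_sum_le_sum_abs _ _).trans ((Finset.sum_le_card_nsmul _ _ _ h).trans ?_)
  rw [Finset.card_range, nsmul_eq_mul]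
  push_cast
  exact le_of_eq (by ring)

/-- The error of the inner bound in terms of the first eigenvalue. -/
lemma upperBound_le (hq : 2 ≤ q) {ν : ℕ → ℝ} {r D : ℕ} (hν : ∀ k, r < k → ν k = 0)
    (hw : avg (fun z : Fin n → Fin q => rad ν z * rad ν z) = 1) (i : Fin n)
    {f : MvPolynomial (Fin n) ℝ} (hD : f.totalDegree ≤ D) {γ : ℝ}
    (hf : ∀ k ∈ Finset.range (D + 1), ∀ x : Fin n → Fin q, |level (value f) k x| ≤ γ) :
    upperBound q ((q - 1) * r) f ≤ ((minValue q f + γ * (D + 1) * D *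
      (1 - eig (fun z : Fin n → Fin q => rad ν z * rad ν z) {i}) : ℝ) : EReal) := by
  have hW := isWeight_rad hw
  set w := fun z : Fin n → Fin q => rad ν z * rad ν z with hwdef
  obtain ⟨x₀, hx₀⟩ := exists_value_eq_minValue (q := q) f
  obtain ⟨p, hp, hpv⟩ := exists_mvPolynomial_rad hν x₀
  have hsos : IsSOS ((q - 1) * r) (p ^ 2) := ⟨1, fun _ => p, fun _ => hp, by simp⟩
  have hint : ∀ g : MvPolynomial (Fin n) ℝ,
      integral q (g * p ^ 2) = conv w (value g) x₀ := by
    intro g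
    have : integral q (g * p ^ 2) = avg (fun y : Fin n → Fin q => value (g * p ^ 2) y) := rfl
    rw [this, ← avg_shift x₀, conv]
    congr 1
    ext z
    have h1 : value (g * p ^ 2) (x₀ + z) = value g (x₀ + z) * value p (x₀ + z) ^ 2 := by
      simp [value]
    rw [h1, hpv, add_sub_cancel_left, hwdef]
    ring
  have hone : integral q (p ^ 2) = 1 := by
    have h1 := hint 1
    rw [one_mul] at h1
    rw [h1, conv, ← hw]
    simp [value]
  have hcomp : ∀ S : Finset (Fin n), D < S.card → ∀ x : Fin n → Fin q,
      comp (value f) S x = 0 := fun S hS x => comp_value_eq_zero (hD.trans_lt hS) x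
  obtain ⟨c, hc, hc'⟩ := hW.exists_eig_eq
  have hδ : 0 ≤ 1 - eig w {i} := by linarith [hW.eig_le_one hq {i}]
  have hbound := abs_sum_mul_level_le hf (c := fun k => c k - 1) hδ (by
    intro k _
    obtain ⟨S, hS, hk⟩ := hc' k
    rw [abs_sub_comm, hk, abs_of_nonneg (by linarith [hW.eig_le_one hq S])]
    refine (hW.one_sub_eig_le hq S i).trans ?_
    gcongr) x₀
  have hval : conv w (value f) x₀ - value f x₀ =
      ∑ k ∈ Finset.range (D + 1), (c k - 1) * level (value f) k x₀ := by
    rw [conv_eq_sum hq hW.pattern, ← sum_mul_comp_eq_sum_level hcomp (fun k => c k - 1)]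
    conv_lhs => rw [← sum_comp (value f) x₀]
    rw [← Finset.sum_sub_distrib]
    exact Finset.sum_congr rfl fun S _ => by rw [hc]; ring
  refine (iInf₂_le (p ^ 2) ⟨hsos, hone⟩).trans ?_
  rw [EReal.coe_le_coe_iff, hint]
  have := (abs_le.1 hbound).2
  linarith

/-- The error of the outer bound in terms of the eigenvalues. -/
lemma le_lowerBound (hq : 2 ≤ q) {ν : ℕ → ℝ} {r D : ℕ} (hν : ∀ k, r < k → ν k = 0)
    (hw : avg (fun z : Fin n → Fin q => rad ν z * rad ν z) = 1) (i : Fin n)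
    {f : MvPolynomial (Fin n) ℝ} (hD : f.totalDegree ≤ D) {γ : ℝ}
    (hf : ∀ k ∈ Finset.range (D + 1), ∀ x : Fin n → Fin q, |level (value f) k x| ≤ γ)
    {η : ℝ} (hη : 0 < η) (hle : ∀ S : Finset (Fin n), S.card ≤ D →
      η ≤ eig (fun z : Fin n → Fin q => rad ν z * rad ν z) S) :
    ((minValue q f - γ * (D + 1) * D *
      ((1 - eig (fun z : Fin n → Fin q => rad ν z * rad ν z) {i}) / η) : ℝ) : EReal) ≤
      lowerBound q ((q - 1) * r) f := by
  have hW := isWeight_rad hw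
  set w := fun z : Fin n → Fin q => rad ν z * rad ν z with hwdef
  have hcomp : ∀ S : Finset (Fin n), D < S.card → ∀ x : Fin n → Fin q,
      comp (value f) S x = 0 := fun S hS x => comp_value_eq_zero (hD.trans_lt hS) x
  obtain ⟨c, hc, hc'⟩ := hW.exists_eig_eq
  have hδ : 0 ≤ 1 - eig w {i} := by linarith [hW.eig_le_one hq {i}]
  set ε := γ * (D + 1) * D * ((1 - eig w {i}) / η) with hε
  -- The preimage of f - (f_min - ε) under the convolution. Inverses beyond size D are harmless
  -- since those components vanish.
  set g : (Fin n → Fin q) → ℝ := fun y =>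
    ∑ S, (c S.card)⁻¹ * comp (value f) S y - (minValue q f - ε) with hg
  have hg0 : ∀ y, 0 ≤ g y := by
    intro y
    have hbound := abs_sum_mul_level_le hf (c := fun k => (c k)⁻¹ - 1)
      (div_nonneg hδ hη.le) (by
        intro k hk
        obtain ⟨S, hS, hSk⟩ := hc' k
        have hk' := Finset.mem_range.1 hk
        have h1 : η ≤ c k := hSk ▸ hle S (by omega)
        have h2 : c k ≤ 1 := hSk ▸ hW.eig_le_one hq S
        have h3 : 1 - c k ≤ k * (1 - eig w {i}) := by
          rw [hSk]
          refine (hW.one_sub_eig_le hq S i).trans ?_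
          gcongr
        have hpos : 0 < c k := hη.trans_le h1
        have h4 : (c k)⁻¹ - 1 = (1 - c k) / c k := by field_simp
        rw [h4, abs_of_nonneg (div_nonneg (by linarith) hpos.le), ← mul_div_assoc]
        exact div_le_div₀ (by positivity) h3 hη h1) y
    have hval : ∑ S, (c S.card)⁻¹ * comp (value f) S y - value f y =
        ∑ k ∈ Finset.range (D + 1), ((c k)⁻¹ - 1) * level (value f) k y := by
      rw [← sum_mul_comp_eq_sum_level hcomp (fun k => (c k)⁻¹ - 1)]
      nth_rewrite 1 [← sum_comp (value f) y]
      rw [← Finset.sum_sub_distrib]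
      exact Finset.sum_congr rfl fun S _ => by ring
    have := (abs_le.1 hbound).1
    have := minValue_le f y
    simp only [hg]
    linarith
  have hconv : ∀ x, conv w g x = value f x - (minValue q f - ε) := by
    intro x
    have h1 : conv w g x = conv w (fun y => ∑ S, (c S.card)⁻¹ * comp (value f) S y) x -
        (minValue q f - ε) := by
      simp only [conv, hg, mul_sub, avg_sub, avg_mul_const]
      rw [hW.avg_eq]
      ring
    rw [h1, conv_sum_mul_comp hq hW.pattern, ← sum_comp (value f) x]
    congr 1
    refine Finset.sum_congr rfl fun S _ => ?_
    by_cases hS : D < S.card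
    · rw [hcomp S hS, mul_zero]
    · have : 0 < eig w S := hη.trans_le (hle S (not_lt.1 hS))
      rw [← hc S, inv_mul_cancel₀ this.ne', one_mul]
  choose p hp hpv using fun y : Fin n → Fin q => exists_mvPolynomial_rad hν y
  -- The convolution of g with u² is itself a sum over y of squares u(x - y)² with nonnegative
  -- coefficients g(y)/q^n.
  have hsos : IsSOS ((q - 1) * r) (∑ y : Fin n → Fin q,
      (MvPolynomial.C (√(1 / (q : ℝ) ^ n * g y)) * p y) ^ 2) := by
    refine isSOS_sum fun y => (MvPolynomial.totalDegree_mul _ _).trans ?_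
    rw [MvPolynomial.totalDegree_C, zero_add]
    exact hp y
  refine le_iSup₂_of_le (minValue q f - ε) ⟨_, hsos, fun x => ?_⟩ le_rfl
  rw [← hconv x]
  have h1 : conv w g x = avg (fun y => w (y - x) * g y) := by
    rw [← avg_shift x, conv]
    simp
  have h2 : ∀ y, rad ν (y - x) = rad ν (x - y) := fun y =>
    patternDep_rad ν _ _ fun i => by
      simp only [Pi.sub_apply, sub_eq_zero]
      exact eq_comm
  rw [h1, avg, Finset.mul_sum]
  have h3 : ∀ s : (Fin n → Fin q) → MvPolynomial (Fin n) ℝ,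
      value (∑ y, s y) x = ∑ y, value (s y) x := fun s => by simp [value]
  rw [h3]
  refine Finset.sum_congr rfl fun y _ => ?_
  have h4 : value ((MvPolynomial.C (√(1 / (q : ℝ) ^ n * g y)) * p y) ^ 2) x =
      √(1 / (q : ℝ) ^ n * g y) ^ 2 * value (p y) x ^ 2 := by
    simp [value, mul_pow]
  rw [h4, Real.sq_sqrt (mul_nonneg (by positivity) (hg0 y)), hpv, hwdef]
  simp only [h2]
  ring

/-! ### Asymptotics -/

/-- The arithmetic-geometric mean inequality for t and (q-1)(1-t). -/
lemma phi_nonneg {q : ℕ} (hq : 2 ≤ q) {t : ℝ} (h0 : 0 ≤ t) (h1 : t ≤ 1) : 0 ≤ phi q t := by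
  have hq' : (2 : ℝ) ≤ q := by exact_mod_cast hq
  have hs : 2 * √(((q : ℝ) - 1) * t * (1 - t)) ≤ t + (q - 1) * (1 - t) := by
    have h2 : 0 ≤ t + (q - 1) * (1 - t) := by
      have : 0 ≤ ((q : ℝ) - 1) * (1 - t) := mul_nonneg (by linarith) (by linarith)
      linarith
    have h3 : √(((q : ℝ) - 1) * t * (1 - t)) ≤ (t + (q - 1) * (1 - t)) / 2 := by
      refine Real.sqrt_le_iff.2 ⟨by linarith, ?_⟩
      nlinarith [sq_nonneg (t - ((q : ℝ) - 1) * (1 - t))]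
    linarith
  have : phi q t = (((q : ℝ) - 1) - ((q - 2) * t + 2 * √(((q : ℝ) - 1) * t * (1 - t)))) / q := by
    unfold phi; field_simp
  rw [this]
  apply div_nonneg <;> linarith

open Filter Topology in
/-- Kernels whose first eigenvalue is asymptotically at least `1 - q / (q - 1) * phi q t`. -/
lemma eventually_exists_rad (hq : 2 ≤ q) {t : ℝ} (h0 : 0 ≤ t) (h1 : t ≤ ((q : ℝ) - 1) / q)
    {n r : ℕ → ℕ} (hn : Tendsto n atTop atTop)
    (hr : Tendsto (fun j => (r j : ℝ) / (n j : ℝ)) atTop (𝓝 t)) {ε : ℝ} (hε : 0 < ε) :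
    ∀ᶠ j in atTop, ∃ ν : ℕ → ℝ, (∀ k, r j < k → ν k = 0) ∧
      avg (fun z : Fin (n j) → Fin q => rad ν z * rad ν z) = 1 ∧
      ∀ i : Fin (n j), 1 - eig (fun z : Fin (n j) → Fin q => rad ν z * rad ν z) {i} ≤
        q / ((q : ℝ) - 1) * phi q t + ε := by
  have hq' : (2 : ℝ) ≤ q := by exact_mod_cast hq
  have hq1 : (0 : ℝ) < q - 1 := by linarith
  have ht1 : t < 1 := h1.trans_lt (by rw [div_lt_one] <;> linarith)
  set s := √(((q : ℝ) - 1) * t * (1 - t)) with hs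
  have hnR : Tendsto (fun j => (n j : ℝ)) atTop atTop := tendsto_natCast_atTop_atTop.comp hn
  have hphi : q / ((q : ℝ) - 1) * phi q t = 1 - ((q - 2) * t + 2 * s) / (q - 1) := by
    unfold phi
    rw [← hs]
    field_simp
  -- The window length is fixed before j grows. At t = 0 the r j may stay bounded, so l = 0 is
  -- taken; nothing is lost because s = 0.
  obtain ⟨l, hl, hls⟩ : ∃ l : ℕ, (∀ᶠ j in atTop, l ≤ r j) ∧
      ((q - 2) * t + 2 * s) / (q - 1) - ε <
        1 / (q - 1) * ((q - 2) * t + 2 * (l / (l + 1)) * s) := by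
    rcases h0.eq_or_lt with ht | ht
    · refine ⟨0, by simp, ?_⟩
      have : s = 0 := by rw [hs, ← ht]; simp
      rw [this, ← ht]
      simp [hε]
    · have hlim : Tendsto (fun l : ℕ => 1 / ((q : ℝ) - 1) *
          ((q - 2) * t + 2 * ((l : ℝ) / (l + 1)) * s)) atTop
          (𝓝 (1 / ((q : ℝ) - 1) * ((q - 2) * t + 2 * 1 * s))) := by
        have := tendsto_natCast_div_add_atTop (1 : ℝ)
        exact ((((this.const_mul 2).mul_const s).const_add _).const_mul _)
      have hev := hlim.eventually_const_lt (u := ((q - 2) * t + 2 * s) / (q - 1) - ε) (by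
        have : 1 / ((q : ℝ) - 1) * ((q - 2) * t + 2 * 1 * s) =
          ((q - 2) * t + 2 * s) / (q - 1) := by ring
        linarith)
      obtain ⟨l, hl⟩ := hev.exists
      refine ⟨l, ?_, hl⟩
      have hrt : Tendsto (fun j => (r j : ℝ)) atTop atTop := by
        have := hr.pos_mul_atTop ht hnR
        refine this.congr' ?_
        filter_upwards [hn.eventually_gt_atTop 0] with j hj
        have : (n j : ℝ) ≠ 0 := by positivity
        field_simp
      filter_upwards [hrt.eventually_ge_atTop (l : ℝ)] with j hj
      exact_mod_cast hj
  have hln : Tendsto (fun j => (l : ℝ) / n j) atTop (𝓝 0) := hnR.const_div_atTop _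
  have hlim : Tendsto (fun j => 1 / ((q : ℝ) - 1) * ((q - 2) * ((r j : ℝ) / n j - l / n j) +
      2 * (l / (l + 1)) * √((q - 1) * ((r j : ℝ) / n j - l / n j) * (1 - (r j : ℝ) / n j))))
      atTop (𝓝 (1 / ((q : ℝ) - 1) * ((q - 2) * t + 2 * (l / (l + 1)) * s))) := by
    have ha : Tendsto (fun j => (r j : ℝ) / n j - l / n j) atTop (𝓝 t) := by
      simpa using hr.sub hln
    have hb : Tendsto (fun j => 1 - (r j : ℝ) / n j) atTop (𝓝 (1 - t)) := hr.const_sub 1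
    exact ((ha.const_mul _).add
      (((((ha.const_mul _).mul hb).sqrt)).const_mul _)).const_mul _
  filter_upwards [hl, hlim.eventually_const_lt hls, hn.eventually_gt_atTop 0,
    hr.eventually_lt_const ht1] with j hlj hj hnj hrj
  have hnpos : (0 : ℝ) < n j := by exact_mod_cast hnj
  have hrn : r j ≤ n j := by
    rw [div_lt_one hnpos] at hrj
    exact_mod_cast hrj.le
  obtain ⟨ν, hν, hν1, hν2⟩ := exists_rad (q := q) (n := n j) hq (a := r j - l) (l := l) (by omega)
  refine ⟨ν, fun k hk => hν k (by omega), hν1, fun i => ?_⟩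
  rw [eig_singleton_rad hν1, hphi]
  have hcast : ((r j - l : ℕ) : ℝ) = r j - l := Nat.cast_sub hlj
  rw [hcast] at hν2
  have hsq : √(((q : ℝ) - 1) * (r j - l) * (n j - (r j - l) - l)) =
      n j * √((q - 1) * ((r j : ℝ) / n j - l / n j) * (1 - (r j : ℝ) / n j)) := by
    have : ((q : ℝ) - 1) * (r j - l) * (n j - (r j - l) - l) =
        (n j : ℝ) ^ 2 * ((q - 1) * ((r j : ℝ) / n j - l / n j) * (1 - (r j : ℝ) / n j)) := by
      field_simp
      ring
    rw [this, Real.sqrt_mul (by positivity), Real.sqrt_sq hnpos.le]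
  rw [hsq] at hν2
  have hfin : 1 / ((q : ℝ) - 1) * ((q - 2) * ((r j : ℝ) / n j - l / n j) +
      2 * (l / (l + 1)) * √((q - 1) * ((r j : ℝ) / n j - l / n j) * (1 - (r j : ℝ) / n j))) ≤
      1 / (n j * ((q : ℝ) - 1)) * avg (fun z : Fin (n j) → Fin q =>
        rad ν z * rad ν z * ∑ i, gen (z i)) := by
    refine le_trans (le_of_eq ?_) (mul_le_mul_of_nonneg_left hν2 (by positivity))
    field_simp
  linarith

open Filter in
lemma limsup_le_of_forall_eventually_le {u : ℕ → EReal} {b : ℝ}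
    (h : ∀ ε : ℝ, 0 < ε → ∀ᶠ j in atTop, u j ≤ ((b + ε : ℝ) : EReal)) :
    limsup u atTop ≤ (b : EReal) := by
  rw [← EReal.le_of_forall_lt_iff_le]
  intro z hz
  have hz' : b < z := EReal.coe_lt_coe_iff.1 hz
  refine limsup_le_of_le (by isBoundedDefault) ?_
  have := h (z - b) (by linarith)
  simpa using this

/-- A lower bound for the eigenvalues of a weight whose first eigenvalue is close to `1`. -/
lemma IsWeight.le_eig {w : (Fin n → Fin q) → ℝ} (hw : IsWeight w) (hq : 2 ≤ q) {d : ℕ}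
    {x : ℝ} (hx : 0 ≤ x) (hd : (d : ℝ) * (d + 1) * x ≤ 1 / 2) (i : Fin n)
    (hi : 1 - eig w {i} ≤ q / ((q : ℝ) - 1) * x + 1 / (8 * (d + 1)))
    (hn : 2 * (((q - 1) * d : ℕ) : ℝ) ^ 2 / n ≤ (1 / 2) ^ ((q - 1) * d + 2))
    (S : Finset (Fin n)) (hS : S.card ≤ (q - 1) * d) :
    (1 / 2) ^ ((q - 1) * d + 2) ≤ eig w S := by
  have hpow : ((1 : ℝ) / 2) ^ ((q - 1) * d + 2) ≤ 1 / 4 := by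
    rw [pow_add]
    have : ((1 : ℝ) / 2) ^ ((q - 1) * d) ≤ 1 := pow_le_one₀ (by norm_num) (by norm_num)
    linarith
  rcases Nat.eq_zero_or_pos d with rfl | hd1
  · have : S = ∅ := by simpa using hS
    rw [this, hw.eig_empty]
    linarith
  have hd1' : (1 : ℝ) ≤ d := by exact_mod_cast hd1
  -- For q = 2, |S| ≤ d and the linear estimate leaves an eigenvalue of at least 1/4. For q ≥ 3, x ≤
  -- 1/4 gives 1 - c_1 ≤ 3/2 · 1/4 + 1/8 = 1/2, as the moment bound requires.
  rcases hq.eq_or_lt with rfl | hq3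
  · have h1 := hw.one_sub_eig_le hq S i
    have hS' : (S.card : ℝ) ≤ d := by exact_mod_cast (by simpa using hS)
    have h2 : (d : ℝ) * (2 * x + 1 / (8 * (d + 1))) ≤ 3 / 4 := by
      have h3 : (d : ℝ) * (1 / (8 * (d + 1))) ≤ 1 / 8 := by
        rw [mul_one_div, div_le_div_iff₀ (by positivity) (by norm_num)]
        linarith
      have h4 : (d : ℝ) * x * 2 ≤ d * x * (d + 1) := by
        have : 0 ≤ (d : ℝ) * x := by positivity
        gcongr
        linarith
      nlinarith
    have h5 : (S.card : ℝ) * (1 - eig w {i}) ≤ d * (2 * x + 1 / (8 * (d + 1))) := by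
      refine mul_le_mul hS' (hi.trans (le_of_eq ?_)) ?_ (by positivity)
      · norm_num
      · linarith [hw.eig_le_one hq {i}]
    linarith
  · have hq3' : (3 : ℝ) ≤ q := by exact_mod_cast hq3
    have hx4 : x ≤ 1 / 4 := by
      have : 2 * x ≤ d * (d + 1) * x := by
        gcongr
        nlinarith
      linarith
    have h1 : q / ((q : ℝ) - 1) ≤ 3 / 2 := by
      rw [div_le_div_iff₀] <;> linarith
    have h2 : 1 / (8 * ((d : ℝ) + 1)) ≤ 1 / 8 := by
      apply one_div_le_one_div_of_le <;> linarith
    have h3 : q / ((q : ℝ) - 1) * x ≤ 3 / 2 * (1 / 4) :=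
      mul_le_mul h1 hx4 hx (by norm_num)
    have h4 := hw.le_eig_of_three_le hq3 i (by linarith) S
    have h5 : 2 * (S.card : ℝ) ^ 2 / n ≤ 2 * (((q - 1) * d : ℕ) : ℝ) ^ 2 / n := by
      gcongr
    have h6 : ((1 : ℝ) / 2) ^ ((q - 1) * d) ≤ (1 / 2) ^ S.card :=
      pow_le_pow_of_le_one (by norm_num) (by norm_num) hS
    have h7 : ((1 : ℝ) / 2) ^ ((q - 1) * d + 2) = (1 / 2) ^ ((q - 1) * d) / 4 := by
      rw [pow_add]; ring
    have h8 : (0 : ℝ) < (1 / 2) ^ ((q - 1) * d) := by positivity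
    linarith

end

end QaryCube

end

/-! ### The main theorem -/

theorem mainTheorem7 (q : ℕ) (hq : 2 ≤ q) (d : ℕ) :
    ∃ C : ℝ, 0 < C ∧
      ∀ t : ℝ, 0 ≤ t → t ≤ ((q : ℝ) - 1) / q →
        ∀ n r : ℕ → ℕ,
          Filter.Tendsto n Filter.atTop Filter.atTop →
          Filter.Tendsto (fun j => (r j : ℝ) / (n j : ℝ)) Filter.atTop (nhds t) →
          Filter.limsup (fun j => QaryCube.innerError q ((q - 1) * d) ((q - 1) * r j) (n j))
              Filter.atTop ≤ ((C * QaryCube.phi q t : ℝ) : EReal) ∧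
          ((d : ℝ) * ((d : ℝ) + 1) * QaryCube.phi q t ≤ 1 / 2 →
            Filter.limsup (fun j => QaryCube.outerError q ((q - 1) * d) ((q - 1) * r j) (n j))
              Filter.atTop ≤ ((2 * C * QaryCube.phi q t : ℝ) : EReal)) := by
  have : NeZero q := ⟨by omega⟩
  have hq' : (2 : ℝ) ≤ q := by exact_mod_cast hq
  have hq1 : (0 : ℝ) < q - 1 := by linarith
  set D := (q - 1) * d with hD
  obtain ⟨γ, hγ, hlevel⟩ := QaryCube.exists_level_bound D
  set η : ℝ := (1 / 2) ^ (D + 2) with hη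
  have hη0 : 0 < η := by positivity
  have hη1 : η ≤ 1 := pow_le_one₀ (by norm_num) (by norm_num)
  set B : ℝ := γ * (D + 1) * D with hB
  have hB0 : 0 ≤ B := by positivity
  have hBη : B ≤ B / η := le_div_self hB0 hη0 hη1
  set K : ℝ := q / ((q : ℝ) - 1) with hK
  have hK0 : 0 ≤ K := by positivity
  -- The summand 1 only secures positivity, as B = 0 when d = 0. The constant B / η * K already
  -- serves both bounds; the factor 2 in the outer one is slack.
  refine ⟨B / η * K + 1, by positivity, fun t h0 h1 n r hn hr => ?_⟩
  have hphi : 0 ≤ QaryCube.phi q t :=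
    QaryCube.phi_nonneg hq h0 (h1.trans (by rw [div_le_one] <;> linarith))
  have hlev : ∀ (m : ℕ) (f : MvPolynomial (Fin m) ℝ),
      f.totalDegree ≤ D ∧ QaryCube.supNorm q f = 1 → ∀ k ∈ Finset.range (D + 1),
      ∀ x : Fin m → Fin q, |QaryCube.level (QaryCube.value f) k x| ≤ γ := by
    intro m f hf k hk x
    have := hlevel q m (QaryCube.value f) 1
      (fun x => (QaryCube.abs_value_le_supNorm f x).trans hf.2.le)
      (fun S hS x => QaryCube.comp_value_eq_zero (hf.1.trans_lt hS) x) k hk x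
    simpa using this
  have hscale : ∀ ε : ℝ, 0 < ε → B / η * (ε / (B / η + 1)) ≤ ε := by
    intro ε hε
    have hpos : 0 < B / η + 1 := by positivity
    rw [mul_div_assoc', div_le_iff₀ hpos]
    linarith
  constructor
  · refine QaryCube.limsup_le_of_forall_eventually_le fun ε hε => ?_
    have hε' : 0 < ε / (B / η + 1) := by positivity
    filter_upwards [QaryCube.eventually_exists_rad hq h0 h1 hn hr hε',
      hn.eventually_gt_atTop 0] with j ⟨ν, hν, hν1, hν2⟩ hnj
    refine iSup₂_le fun f hf => ?_
    have h2 := QaryCube.upperBound_le hq hν hν1 ⟨0, hnj⟩ hf.1 (hlev _ f hf)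
    refine (EReal.sub_le_sub h2 le_rfl).trans ?_
    rw [← EReal.coe_sub, EReal.coe_le_coe_iff, add_sub_cancel_left, ← hB]
    have h3 := hν2 ⟨0, hnj⟩
    have h4 := hscale ε hε
    calc _ ≤ B * (K * QaryCube.phi q t + ε / (B / η + 1)) := mul_le_mul_of_nonneg_left h3 hB0
      _ ≤ B / η * (K * QaryCube.phi q t + ε / (B / η + 1)) :=
          mul_le_mul_of_nonneg_right hBη (by positivity)
      _ ≤ _ := by nlinarith
  · intro hd
    refine QaryCube.limsup_le_of_forall_eventually_le fun ε hε => ?_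
    -- The first entry keeps the final error below ε, the second meets the tolerance in
    -- `IsWeight.le_eig`.
    have hε' : 0 < min (ε / (B / η + 1)) (1 / (8 * ((d : ℝ) + 1))) := by positivity
    have hlim : Filter.Tendsto (fun j => 2 * (D : ℝ) ^ 2 / (n j : ℝ)) Filter.atTop (nhds 0) :=
      (tendsto_natCast_atTop_atTop.comp hn).const_div_atTop _
    filter_upwards [QaryCube.eventually_exists_rad hq h0 h1 hn hr hε',
      hn.eventually_gt_atTop 0, hlim.eventually_le_const hη0] with j ⟨ν, hν, hν1, hν2⟩ hnj hnη
    refine iSup₂_le fun f hf => ?_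
    have h3 := hν2 ⟨0, hnj⟩
    have hle := (QaryCube.isWeight_rad hν1).le_eig hq hphi hd ⟨0, hnj⟩
      (h3.trans (by gcongr; exact min_le_right _ _)) hnη
    have h2 := QaryCube.le_lowerBound hq hν hν1 ⟨0, hnj⟩ hf.1 (hlev _ f hf) hη0 hle
    refine (EReal.sub_le_sub le_rfl h2).trans ?_
    rw [← EReal.coe_sub, EReal.coe_le_coe_iff, sub_sub_cancel, ← hB]
    have h4 := hscale ε hε
    have h5 : min (ε / (B / η + 1)) (1 / (8 * ((d : ℝ) + 1))) ≤ ε / (B / η + 1) := min_le_left _ _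
    calc _ = B / η * (1 - QaryCube.eig (fun z : Fin (n j) → Fin q =>
            QaryCube.rad ν z * QaryCube.rad ν z) {⟨0, hnj⟩}) := by ring
      _ ≤ B / η * (K * QaryCube.phi q t + ε / (B / η + 1)) :=
          mul_le_mul_of_nonneg_left (h3.trans (by linarith)) (by positivity)
      _ ≤ _ := by
          have : 0 ≤ B / η * K * QaryCube.phi q t := by positivity
          nlinarith
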